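/- Let $\mathcal F$ be the Farey tessellation of the hyperbolic plane (upper half-plane model): its vertices are the points of $\hat{\mathbf Q}=\mathbf Q\cup\{\infty\}$, and $p/q$, $p'/q'$ in lowest terms ($\infty=1/0$) are joined by a geodesic (edge) of $\mathcal F$ iff $|pq'-p'q|=1$. Each edge $e=(b,d)$ is the common side of exactly two complementary triangles, with vertices $a,b,d$ and $b,c,d$, where $a,b,c,d$ are named so that they are positively cyclically ordered on $\mathbf R\cup\{\infty\}$. The shear on $e$ of a map $h$ of $\mathbf R\cup\{\infty\}$ fixing $\infty$ is $\log cr(h(a),h(b),h(c),h(d))$, where $cr(a,b,c,d)=\frac{(c-b)(d-a)}{(b-a)(d-c)}$. A normalized Zygmund vector field is a continuous $V:\mathbf R\to\mathbf R$ with $V(0)=V(1)=0$ and $V(x)=O(|x|\log|x|)$ as $x\to\pm\infty$ ("$V$ vanishes at $0,1,\infty$"), for which there is $K>0$ with $$|V(x+t)+V(x-t)-2V(x)|\le Kt\qquad\text{for all }x\in\mathbf R,\ t>0 .$$ The smallest such $K\ge 0$ is its Zygmund norm. Let $\mathcal Z$ be the space of these vector fields; it is the standard model of the tangent space to the universal Teichmüller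 space at the basepoint. The infinitesimal shear function of $V\in\mathcal Z$ is the function $\dot s:\mathcal F\to\mathbf R$ on the edges such that, for every path $h_t$ of maps of $\mathbf R\cup\{\infty\}$ fixing $\infty$ with $h_0=\mathrm{id}$ and $\frac{d}{dt}h_t(x)|_{t=0}=V(x)$ for all $x\in\mathbf R$, the derivative at $t=0$ of the shear of $h_t$ on $e$ exists and equals $\dot s(e)$, for every edge $e$. For $p\in\hat{\mathbf Q}$ the fan $\mathcal F_p=\{e_n\}_{n\in\mathbf Z}$ with tip $p$ is the set of all edges with endpoint $p$, enumerated by $\mathbf Z$ so that $e_n$ and $e_{n+1}$ are sides of a common complementary triangle. A function $\dot s:\mathcal F\to\mathbf R$ satisfies (10) with constant $C$ if $$\left|\dot s(e_m)+\sum_{j=1}^{k}\frac{k+1-j}{k+1}\,\bigl[\dot s(e_{m+j})+\dot s(e_{m-j})\bigr]\right|\le C \tag{10}$$ for all fans $\mathcal F_p=\{e_n\}_{n\in\mathbf Z}$ and all $m,k\in\mathbf Z$, $k\ge 0$. **Theorem 4.1.** Every $V\in\mathcal Z$ has exactly one infinitesimal shear function. An arbitrary function $\dot s:\mathcal F\to\mathbf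 R$ is the infinitesimal shear function of some $V\in\mathcal Z$ if and only if there is a constant $C>0$ such that $\dot s$ satisfies (10) with the constant $C$ in all fans. The vector field $V\in\mathcal Z$ is uniquely determined by its infinitesimal shear function, so that $\mathcal Z$ is parametrized bijectively by the functions $\dot s$ satisfying (10) for some $C$. Moreover, for each $C>0$ there is $M(C)>0$ such that, whenever $\dot s$ satisfies (10) with the constant $C$, the vector field $V\in\mathcal Z$ with infinitesimal shear function $\dot s$ has Zygmund norm at most $M(C)$. -/

import Mathlib

open scoped OnePoint

namespace Farey

noncomputable section

/-- The difference `x - y` of two points of the projective line `K ∪ {∞}`, computed in the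
homogeneous coordinates `(x, 1)` for `x : K` and `(1, 0)` for `∞`. -/
def diff {K : Type*} [Field K] (x y : OnePoint K) : K :=
  x.elim (y.elim 0 fun _ => 1) fun a => y.elim (-1) fun b => a - b

/-- The cross-ratio `(c - b)(d - a) / ((b - a)(d - c))` of four points of `K ∪ {∞}`; if one of
the points is `∞`, this is the limit of the formula at that point. -/
def crossRatio {K : Type*} [Field K] (a b c d : OnePoint K) : K :=
  diff c b * diff d a / (diff b a * diff d c)

/-- The points `p`, `q`, `r` of the circle `ℚ ∪ {∞} ⊆ ℝ ∪ {∞}` are distinct and follow each other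
in the positive direction (the direction of increasing numbers). -/
def CyclicPos (p q r : OnePoint ℚ) : Prop :=
  0 < diff p q * diff q r * diff r p

/-- Numerator of an extended rational number, `∞ = 1 / 0`. -/
def num (p : OnePoint ℚ) : ℤ := p.elim 1 Rat.num

/-- Denominator of an extended rational number, `∞ = 1 / 0`. -/
def den (p : OnePoint ℚ) : ℤ := p.elim 0 fun q => (q.den : ℤ)

/-- The Farey tessellation. Its vertices are the extended rational numbers; two vertices are joined
by a geodesic of the tessellation if the determinant of their reduced fractions is `±1`. Its
complementary triangles are the ideal triangles whose three vertices are pairwise joined. -/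
def fareyGraph : SimpleGraph (OnePoint ℚ) where
  Adj p q := |num p * den q - num q * den p| = 1
  symm := ⟨fun p q h => by rw [← h, ← abs_neg]; congr 1; ring⟩
  loopless := ⟨fun p h => by simp at h⟩

/-- The edges (geodesics) of the Farey tessellation, each given by its two endpoints. -/
abbrev Edge : Type := fareyGraph.edgeSet

/-- The edge with endpoints `b`, `d` is the common side of the two complementary triangles with
vertices `a, b, d` and `b, c, d`, and `a, b, c, d` are in the positive cyclic order. -/
structure IsQuad (a b c d : OnePoint ℚ) : Prop where
  diag : fareyGraph.Adj b d
  ab : fareyGraph.Adj a b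
  ad : fareyGraph.Adj a d
  cb : fareyGraph.Adj c b
  cd : fareyGraph.Adj c d
  pos_abc : CyclicPos a b c
  pos_cda : CyclicPos c d a

/-- The shear of a map `h : ℝ → ℝ`, extended by `∞ ↦ ∞`, on the diagonal `(b, d)` of the
quadrilateral `a, b, c, d`: the logarithm of the cross-ratio of the image quadrilateral. -/
def shear (h : ℝ → ℝ) (a b c d : OnePoint ℚ) : ℝ :=
  let H : OnePoint ℚ → OnePoint ℝ := OnePoint.map fun q : ℚ => h (q : ℝ)
  Real.log (crossRatio (H a) (H b) (H c) (H d))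

/-- `h t`, for `t` near `0`, is a path of maps of `ℝ ∪ {∞}` which fix `∞`, starting at the identity
and with initial velocity `V`: `h 0 = id` and `d/dt h t x = V x` at `t = 0`, for every `x`. -/
structure IsPathTangentTo (h : ℝ → ℝ → ℝ) (V : ℝ → ℝ) : Prop where
  zero : ∀ x, h 0 x = x
  deriv : ∀ x, HasDerivAt (fun t => h t x) (V x) 0

/-- `s` is the infinitesimal shear function of the vector field `V` (vanishing at `∞`): along any
path `h t` with `h 0 = id` and velocity `V` at `t = 0`, the derivative at `t = 0` of the shear of
`h t` on every edge `e` is `s e`. (Such paths exist for every `V`, for instance `x + t * V x`, and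
the derivative of the shears does not depend on the path.) -/
def IsInfinitesimalShear (V : ℝ → ℝ) (s : Edge → ℝ) : Prop :=
  ∀ h : ℝ → ℝ → ℝ, IsPathTangentTo h V →
    ∀ a b c d : OnePoint ℚ, ∀ hq : IsQuad a b c d,
      HasDerivAt (fun t => shear (h t) a b c d) (s ⟨s(b, d), hq.diag⟩) 0

/-- `V` is Zygmund bounded with constant `C` on the whole line, that is, its Zygmund norm is at
most `C`. -/
def ZygmundBounded (C : ℝ) (V : ℝ → ℝ) : Prop :=
  ∀ x t : ℝ, 0 < t → |V (x + t) + V (x - t) - 2 * V x| ≤ C * t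

/-- Zygmund vector fields on `ℝ ∪ {∞}` normalized to vanish at `0`, `1` and `∞`; vanishing at `∞`
means that `V x = O(|x| log |x|)` as `x → ±∞`. -/
structure IsNormalizedZygmund (V : ℝ → ℝ) : Prop where
  continuous : Continuous V
  zygmund : ∃ C : ℝ, 0 < C ∧ ZygmundBounded C V
  map_zero : V 0 = 0
  map_one : V 1 = 0
  vanish_infty : V =O[Filter.atBot ⊔ Filter.atTop] fun x : ℝ => |x| * Real.log |x|

/-- `e` is an enumeration by the integers of the fan with tip `p`, i.e. of all edges with endpoint
`p`, such that `e n` is adjacent to `e (n + 1)`: they are two sides of one complementary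
triangle. (It is unique up to translation and reversal of `ℤ`.) -/
structure IsFan (p : OnePoint ℚ) (e : ℤ → Edge) : Prop where
  injective : Function.Injective e
  range_eq : Set.range e = {E : Edge | p ∈ (E : Sym2 (OnePoint ℚ))}
  adjacent : ∀ n : ℤ, ∃ q r : OnePoint ℚ,
    (e n : Sym2 (OnePoint ℚ)) = s(p, q) ∧ (e (n + 1) : Sym2 (OnePoint ℚ)) = s(p, r) ∧
      fareyGraph.Adj q r

/-- The Cesàro-type bound with constant `C`, in every fan. -/
def CesaroBound (C : ℝ) (s : Edge → ℝ) : Prop :=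
  ∀ (p : OnePoint ℚ) (e : ℤ → Edge), IsFan p e → ∀ (m : ℤ) (k : ℕ),
    |s (e m) + ∑ j ∈ Finset.Icc 1 k,
      (((k : ℝ) + 1 - (j : ℝ)) / ((k : ℝ) + 1)) * (s (e (m + (j : ℤ))) + s (e (m - (j : ℤ))))| ≤ C

end

end Farey

namespace Farey

noncomputable section

/-! Lift `V` to the function `F(x, y) = y² V(x / y)`, homogeneous of degree 2. Its parallelogram
defect `F(u + v) + F(u - v) - 2 F(u) - 2 F(v)` at a lattice basis `u`, `v` is the infinitesimal
shear on the edge joining the two vertices (`IsPathTangentTo.hasDerivAt_shear`). Quadratic forms,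
the lifts of infinitesimal Möbius maps, have no defect, and unimodular substitutions permute the
edges, so everything is covariant under the modular group.

In the fan with tip `v` the shears are second differences of `n ↦ F(u + n v)`, minus a constant. The
Fejér weights in (10) telescope twice, and (10) becomes `FanBound`: `|F(u + N v) + F(u - N v) - 2
F(u) - 2 N² F(v)| ≤ C N` with `N = k + 1`.

A Zygmund bound gives this because it extends to arbitrary pairs of vectors: the defect is at most a
constant times the determinant (`CoarseZygmund.defect_le`). Conversely, normalize `F` to vanish at
`(1, 0)`, `(0, 1)`, `(1, 1)`. A Euclidean descent gives `|F(m, n)| ≤ C n²` for `0 ≤ m ≤ n`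
(`FanBound.abs_le_sq`), so `V` is close to its interpolation at the integers, and the fan at `∞`
makes it Zygmund up to an additive error. To remove the error at `x`, `t`, apply a modular
substitution that brings `x + i t` to height at least `1/2`; the error then becomes a multiple of
`t` (`FanBound.zygmund`).

Every edge function has a potential `F`, built by descending the Farey tree. With `V` vanishing at
`0`, `1`, `∞`, zero shears force Zygmund constant `0`, hence `V = 0`. -/

/-! ### Second differences and interpolation. -/

/-- Maximum principle: from a maximum `m` of `|g|`, step as far as the nearer endpoint, where `g =
0`. The opposite point stays in the interval, so its value is at most `|g m|`, and the step is at
most `n / 2`. -/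
theorem abs_le_of_second_difference_le {g : ℤ → ℝ} {n : ℤ} {A B : ℝ} (hA : 0 ≤ A) (hB : 0 ≤ B)
    (h0 : g 0 = 0) (hn : g n = 0)
    (h : ∀ i k : ℤ, 1 ≤ k → |g (i + k) + g (i - k) - 2 * g i| ≤ A * k + B)
    {j : ℤ} (hj0 : 0 ≤ j) (hjn : j ≤ n) : |g j| ≤ A * n / 2 + B := by
  obtain ⟨m, hm, hmax⟩ := Finset.exists_max_image (Finset.Icc 0 n) (fun i => |g i|)
    ⟨j, Finset.mem_Icc.2 ⟨hj0, hjn⟩⟩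
  rw [Finset.mem_Icc] at hm
  refine (hmax j (Finset.mem_Icc.2 ⟨hj0, hjn⟩)).trans ?_
  have hn0 : (0 : ℝ) ≤ n := by exact_mod_cast hj0.trans hjn
  have hpos : 0 ≤ A * n / 2 + B := by positivity
  have key : ∀ k l : ℤ, 1 ≤ k → 2 * k ≤ n → 0 ≤ l → l ≤ n →
      |g l + 0 - 2 * g m| ≤ A * k + B → |g m| ≤ A * n / 2 + B := by
    intro k l hk hkn hl0 hln hkl
    have h1 := hmax l (Finset.mem_Icc.2 ⟨hl0, hln⟩)
    have h2 : (2 : ℝ) * k ≤ n := by exact_mod_cast hkn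
    have h3 : A * (2 * k) ≤ A * n := mul_le_mul_of_nonneg_left h2 hA
    have h4 : |2 * g m| ≤ |g l| + |g l + 0 - 2 * g m| := by
      have := abs_sub (g l) (g l + 0 - 2 * g m)
      rwa [show g l - (g l + 0 - 2 * g m) = 2 * g m by ring] at this
    rw [abs_mul, abs_two] at h4
    linarith
  rcases le_or_gt (2 * m) n with hmn | hmn
  · rcases hm.1.eq_or_lt with h0m | h0m
    · rw [← h0m, h0, abs_zero]; exact hpos
    · refine key m (2 * m) h0m hmn (by lia) hmn ?_
      have := h m m h0m
      rwa [sub_self, h0, ← two_mul] at this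
  · rcases hm.2.eq_or_lt with hnm | hnm
    · rw [hnm, hn, abs_zero]; exact hpos
    · refine key (n - m) (2 * m - n) (by lia) (by lia) (by lia) (by lia) ?_
      have := h m (n - m) (by lia)
      rw [add_sub_cancel, hn, show m - (n - m) = 2 * m - n by ring] at this
      rwa [add_comm]

/-- `V` satisfies the Zygmund condition up to an additive error. -/
def CoarseZygmund (A B : ℝ) (V : ℚ → ℝ) : Prop :=
  ∀ x t : ℚ, 0 < t → |V (x + t) + V (x - t) - 2 * V x| ≤ A * t + B

/-- The deviation from the chord, sampled in steps of `(b - a) / θ.den`, vanishes at both ends and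
has the same second differences as `V`. -/
theorem CoarseZygmund.interpolation {A B : ℝ} {V : ℚ → ℝ} (hA : 0 ≤ A) (hB : 0 ≤ B)
    (h : CoarseZygmund A B V) {a b : ℚ} (hab : a < b) {θ : ℚ} (h0 : 0 ≤ θ) (h1 : θ ≤ 1) :
    |V (a + θ * (b - a)) - ((1 - θ) * V a + θ * V b)| ≤ A * (b - a) / 2 + B := by
  have hd : (0 : ℚ) < θ.den := by exact_mod_cast θ.pos
  have hdR : (0 : ℝ) < θ.den := by exact_mod_cast θ.pos
  set g : ℤ → ℝ := fun j => V (a + (j / θ.den) * (b - a)) -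
    ((1 - j / θ.den) * V a + j / θ.den * V b) with hg
  have hθ : (θ.num : ℚ) / θ.den = θ := Rat.num_div_den θ
  have hθR : (θ.num : ℝ) / θ.den = θ := by exact_mod_cast congrArg (Rat.cast : ℚ → ℝ) hθ
  have hAb : 0 ≤ A * ((b - a : ℚ) / θ.den : ℝ) := by
    have : (0 : ℝ) ≤ (b - a : ℚ) := by exact_mod_cast (sub_pos.2 hab).le
    positivity
  have hnum : 0 ≤ θ.num := Rat.num_nonneg.2 h0
  have hle : θ.num ≤ (θ.den : ℤ) := by
    rw [← hθ, div_le_one hd] at h1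
    exact_mod_cast h1
  have := abs_le_of_second_difference_le (g := g) (n := θ.den) hAb hB ?_ ?_ ?_ hnum hle
  · simp only [hg] at this
    rw [hθ, hθR] at this
    refine this.trans (le_of_eq ?_)
    push_cast
    field_simp
  · simp [hg]
  · simp only [hg]
    have e1 : ((θ.den : ℤ) : ℚ) / θ.den = 1 := by push_cast; exact div_self hd.ne'
    have e2 : ((θ.den : ℤ) : ℝ) / θ.den = 1 := by push_cast; exact div_self hdR.ne'
    rw [e1, e2]
    simp
  · intro i k hk
    have hk' : (0 : ℚ) < k := by exact_mod_cast hk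
    have := h (a + (i / θ.den) * (b - a)) (k / θ.den * (b - a))
      (mul_pos (div_pos hk' hd) (sub_pos.2 hab))
    simp only [hg]
    push_cast at this ⊢
    rw [show a + ((i : ℚ) + k) / θ.den * (b - a) = a + i / θ.den * (b - a) + k / θ.den * (b - a) by
      ring, show a + ((i : ℚ) - k) / θ.den * (b - a) =
      a + i / θ.den * (b - a) - k / θ.den * (b - a) by ring]
    refine (le_of_eq ?_).trans (this.trans (le_of_eq ?_))
    · congr 1; ring
    · ring

/-! ### The homogeneous lift and its parallelogram defect. -/

/-- The lift of the vector field `V` to a function on the plane which is homogeneous of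
degree `2`. -/
def lift (V : ℚ → ℝ) (x y : ℚ) : ℝ := (y : ℝ) ^ 2 * V (x / y)

/-- The amount by which `F` fails to satisfy the parallelogram law at `(a, b)`, `(c, d)`. -/
def defect {K : Type*} [Ring K] (F : K → K → ℝ) (a b c d : K) : ℝ :=
  F (a + c) (b + d) + F (a - c) (b - d) - 2 * F a b - 2 * F c d

theorem lift_mul (V : ℚ → ℝ) (k x y : ℚ) : lift V (k * x) (k * y) = (k : ℝ) ^ 2 * lift V x y := by
  rcases eq_or_ne k 0 with rfl | hk
  · simp [lift]
  · simp only [lift, mul_div_mul_left _ _ hk]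
    push_cast; ring

theorem lift_neg (V : ℚ → ℝ) (x y : ℚ) : lift V (-x) (-y) = lift V x y := by
  simp [lift, neg_div_neg_eq]

theorem lift_neg_left (V : ℚ → ℝ) (x y : ℚ) :
    lift V (-x) y = lift (fun z => V (-z)) x y := by
  simp [lift, neg_div]

theorem lift_zero_right (V : ℚ → ℝ) (x : ℚ) : lift V x 0 = 0 := by simp [lift]

theorem defect_lift_swap (V : ℚ → ℝ) (a b c d : ℚ) :
    defect (lift V) c d a b = defect (lift V) a b c d := by
  have := lift_neg V (c - a) (d - b)
  rw [neg_sub, neg_sub] at this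
  simp only [defect, this, add_comm c a, add_comm d b]
  ring

theorem defect_lift_neg_right (V : ℚ → ℝ) (a b c d : ℚ) :
    defect (lift V) a b (-c) (-d) = defect (lift V) a b c d := by
  simp only [defect, lift_neg, sub_neg_eq_add, ← sub_eq_add_neg]
  ring

theorem defect_lift_neg_left (V : ℚ → ℝ) (a b c d : ℚ) :
    defect (lift V) (-a) (-b) c d = defect (lift V) a b c d := by
  rw [defect_lift_swap, defect_lift_neg_right, defect_lift_swap]

/-- Passing to the sum and the difference multiplies the determinant by `-2` and the sum of squares
by `2`, so the estimate of `CoarseZygmund.defect_le` is unaffected. -/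
theorem defect_lift_add_sub (V : ℚ → ℝ) (a b c d : ℚ) :
    defect (lift V) (a + c) (b + d) (a - c) (b - d) = -2 * defect (lift V) a b c d := by
  have h1 := lift_mul V 2 a b
  have h2 := lift_mul V 2 c d
  simp only [defect, add_add_sub_cancel, add_sub_sub_cancel, ← two_mul, h1, h2]
  push_cast; ring

theorem CoarseZygmund.comp_neg {A B : ℝ} {V : ℚ → ℝ} (h : CoarseZygmund A B V) :
    CoarseZygmund A B fun z => V (-z) := by
  intro x t ht
  have := h (-x) t ht
  rw [add_comm (V _)] at this
  convert this using 5 <;> ring_nf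

/-- For `u = (p, y + k)` and `v = (x, y)` the defect combines two interpolation errors: that of the
mediant `u + v` between `v` and `u`, and that of `u` between `v` and `u - v`. The bound `k ≤ 2 * y`
keeps the two denominators comparable. -/
theorem CoarseZygmund.defect_core {A B : ℝ} {V : ℚ → ℝ} (hA : 0 ≤ A) (hB : 0 ≤ B)
    (h : CoarseZygmund A B V) {x y p k : ℚ} (hy : 0 < y) (hk : 0 ≤ k) (hky : k ≤ 2 * y)
    (hD : 0 < p * y - x * (y + k)) :
    |defect (lift V) p (y + k) x y| ≤
      5 * (A * |(p : ℝ) * y - x * (y + k)| + B * ((y + k) ^ 2 + y ^ 2)) := by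
  have hyk : 0 < y + k := by linarith
  have h2y : 0 < y + k + y := by linarith
  rw [← Rat.cast_lt (K := ℝ)] at hy hyk h2y
  have hyR := hy
  have hykR := hyk
  have hkR : (0 : ℝ) ≤ k := by exact_mod_cast hk
  have hkyR : (k : ℝ) ≤ 2 * y := by exact_mod_cast hky
  rw [Rat.cast_lt] at hy hyk h2y
  have hDR : (0 : ℝ) < p * y - x * (y + k) := by exact_mod_cast hD
  push_cast at hyR hykR
  rw [abs_of_pos hDR]
  have hlt : x / y < p / (y + k) := by
    rw [div_lt_div_iff₀ hy hyk]; linarith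
  have e1 := h.interpolation hA hB hlt (θ := (y + k) / (y + k + y))
    (by positivity) ((div_le_one h2y).2 (by linarith))
  rw [show x / y + (y + k) / (y + k + y) * (p / (y + k) - x / y) = (p + x) / (y + k + y) by
    field_simp; ring] at e1
  set E1 := V ((p + x) / (y + k + y)) - _ with hE1
  -- For `k = 0` the vector `u - v` lies over `∞`, where the lift vanishes, and the first error
  -- suffices.
  rcases hk.eq_or_lt with rfl | hk0
  · have hV : defect (lift V) p (y + 0) x y = (2 * y) ^ 2 * E1 := by
      rw [hE1]
      simp only [defect, lift, add_zero, sub_self]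
      push_cast
      field_simp
      ring
    rw [hV, abs_mul, abs_of_nonneg (by positivity)]
    have e1' : |E1| ≤ A * ((p * y - x * y) / (2 * (y * y))) + B := by
      refine e1.trans (le_of_eq ?_)
      push_cast; field_simp; ring
    calc (2 * (y : ℝ)) ^ 2 * |E1|
        ≤ (2 * y) ^ 2 * (A * ((p * y - x * y) / (2 * (y * y))) + B) := by gcongr
      _ = 2 * (A * (p * y - x * y)) + 4 * B * y ^ 2 := by
        field_simp; ring
      _ ≤ _ := by
        push_cast at hDR ⊢
        rw [add_zero] at hDR ⊢
        have := mul_nonneg hA hDR.le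
        have : 0 ≤ B * (y : ℝ) ^ 2 := by positivity
        linarith
  · have hkR' : (0 : ℝ) < k := by exact_mod_cast hk0
    have hlt2 : x / y < (p - x) / k := by
      rw [div_lt_div_iff₀ hy hk0]; linarith
    have e2 := h.interpolation hA hB hlt2 (θ := k / (y + k))
      (by positivity) ((div_le_one hyk).2 (by linarith))
    rw [show x / y + k / (y + k) * ((p - x) / k - x / y) = p / (y + k) by
      field_simp; ring] at e2
    set E2 := V (p / (y + k)) - _ with hE2
    have hV : defect (lift V) p (y + k) x y = (2 * y + k) ^ 2 * E1 - k * (y + k) * E2 := by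
      rw [hE1, hE2]
      simp only [defect, lift, add_sub_cancel_left]
      push_cast
      field_simp
      ring
    have i1 : (2 * (y : ℝ) + k) ^ 2 ≤ 6 * (y * (y + k)) := by nlinarith
    have i2 : (2 * (y : ℝ) + k) ^ 2 ≤ 2 * ((y + k) ^ 2 + y ^ 2) := by nlinarith
    have i3 : (k : ℝ) * (y + k) ≤ (y + k) ^ 2 + y ^ 2 := by nlinarith
    have i4 : (y : ℝ) + k ≤ 3 * y := by linarith
    have e1' : |E1| ≤ A * ((p * y - x * (y + k)) / (2 * (y * (y + k)))) + B := by
      refine e1.trans (le_of_eq ?_)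
      push_cast; field_simp
    have e2' : |E2| ≤ A * ((p * y - x * (y + k)) / (2 * (y * k))) + B := by
      refine e2.trans (le_of_eq ?_)
      push_cast; field_simp; ring
    have n1 : 0 ≤ (2 * (y : ℝ) + k) ^ 2 := by positivity
    have n2 : 0 ≤ (k : ℝ) * (y + k) := by positivity
    have n3 : 0 ≤ A * ((p * y - x * (y + k)) / (2 * (y * (y + k)))) :=
      mul_nonneg hA (div_nonneg hDR.le (by positivity))
    have n4 : 0 ≤ A * ((p * y - x * (y + k)) / (2 * y)) :=
      mul_nonneg hA (div_nonneg hDR.le (by positivity))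
    rw [hV]
    refine (abs_sub _ _).trans ?_
    rw [abs_mul, abs_mul, abs_of_nonneg n1, abs_of_nonneg n2]
    calc (2 * (y : ℝ) + k) ^ 2 * |E1| + k * (y + k) * |E2|
        ≤ (2 * (y : ℝ) + k) ^ 2 * (A * ((p * y - x * (y + k)) / (2 * (y * (y + k)))) + B) +
          k * (y + k) * (A * ((p * y - x * (y + k)) / (2 * (y * k))) + B) := by gcongr
      _ = (2 * (y : ℝ) + k) ^ 2 * (A * ((p * y - x * (y + k)) / (2 * (y * (y + k))))) +
          (2 * (y : ℝ) + k) ^ 2 * B + (y + k) * (A * ((p * y - x * (y + k)) / (2 * y)))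
          + k * (y + k) * B := by
        field_simp; ring
      _ ≤ 6 * (y * (y + k)) * (A * ((p * y - x * (y + k)) / (2 * (y * (y + k))))) +
          2 * ((y + k) ^ 2 + y ^ 2) * B + (3 * y) * (A * ((p * y - x * (y + k)) / (2 * y)))
          + ((y + k) ^ 2 + y ^ 2) * B := by
        gcongr
      _ = 9 / 2 * (A * (p * y - x * (y + k))) + 3 * (B * ((y + k) ^ 2 + y ^ 2)) := by
        field_simp; ring
      _ ≤ _ := by
        have := mul_nonneg hA hDR.le
        have : 0 ≤ B * (((y : ℝ) + k) ^ 2 + y ^ 2) := by positivity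
        linarith

theorem CoarseZygmund.defect_le_of_le_three_mul {A B : ℝ} {V : ℚ → ℝ} (hA : 0 ≤ A) (hB : 0 ≤ B)
    (h : CoarseZygmund A B V) {x y p q : ℚ} (hy : 0 < y) (hq : y ≤ q) (hqy : q ≤ 3 * y) :
    |defect (lift V) p q x y| ≤ 5 * (A * |(p : ℝ) * y - x * q| + B * (q ^ 2 + y ^ 2)) := by
  obtain ⟨k, rfl⟩ : ∃ k, q = y + k := ⟨q - y, by ring⟩
  rcases lt_trichotomy (p * y - x * (y + k)) 0 with hD | hD | hD
  -- Reflecting the line reverses the sign of the determinant.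
  · have := h.comp_neg.defect_core (x := -x) (p := -p) hA hB hy (k := k) (by linarith)
      (by linarith) (by linarith)
    have e : (-p : ℝ) * y - -x * (y + k) = -(p * y - x * (y + k)) := by ring
    push_cast at this ⊢
    rw [e, abs_neg] at this
    refine (le_of_eq ?_).trans this
    simp only [defect, ← lift_neg_left, neg_neg, neg_add_rev, neg_sub', add_comm]
  -- Proportional vectors: the lift is a multiple of `w ^ 2` on their line, so the defect is zero.
  · have hyk : 0 < y + k := by linarith
    obtain ⟨z, rfl⟩ : ∃ z, x = z * y := ⟨x / y, by field_simp⟩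
    obtain rfl : p = z * (y + k) := by
      have : y * (p - z * (y + k)) = 0 := by linarith
      rcases mul_eq_zero.1 this with h | h
      · exact absurd h hy.ne'
      · linarith
    have hl : ∀ w, lift V (z * w) w = (w : ℝ) ^ 2 * V z := by
      intro w
      rcases eq_or_ne w 0 with rfl | hw
      · simp [lift]
      · simp [lift, mul_div_assoc, div_self hw]
    have : defect (lift V) (z * (y + k)) (y + k) (z * y) y = 0 := by
      simp only [defect, ← mul_add, ← mul_sub, hl]
      push_cast; ring
    rw [this, abs_zero]
    positivity
  · have := h.defect_core hA hB hy (k := k) (by linarith) (by linarith) hD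
    push_cast
    exact this

theorem CoarseZygmund.defect_le_of_le {A B : ℝ} {V : ℚ → ℝ} (hA : 0 ≤ A) (hB : 0 ≤ B)
    (h : CoarseZygmund A B V) {x y p q : ℚ} (hy : 0 ≤ y) (hq : y ≤ q) :
    |defect (lift V) p q x y| ≤ 5 * (A * |(p : ℝ) * y - x * q| + B * (q ^ 2 + y ^ 2)) := by
  rcases (hy.trans hq).eq_or_lt with rfl | hq0
  · obtain rfl : y = 0 := le_antisymm hq hy
    simp [defect, lift_zero_right]
  rcases le_or_gt q (3 * y) with h3 | h3
  · exact h.defect_le_of_le_three_mul hA hB (by linarith) hq h3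
  -- If `q > 3 * y`, the denominators `q + y` and `q - y` have ratio at most `3`.
  · have := h.defect_le_of_le_three_mul hA hB (x := p - x) (y := q - y) (p := p + x) (q := q + y)
      (by linarith) (by linarith) (by linarith)
    rw [defect_lift_add_sub, abs_mul] at this
    push_cast at this
    rw [show ((p : ℝ) + x) * (q - y) - (p - x) * (q + y) = -2 * (p * y - x * q) by ring,
      abs_mul, abs_neg, abs_two] at this
    have e : B * (((q : ℝ) + y) ^ 2 + (q - y) ^ 2) = 2 * (B * (q ^ 2 + y ^ 2)) := by ring
    rw [e] at this
    linarith

theorem CoarseZygmund.defect_le {A B : ℝ} {V : ℚ → ℝ} (hA : 0 ≤ A) (hB : 0 ≤ B)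
    (h : CoarseZygmund A B V) (p q x y : ℚ) :
    |defect (lift V) p q x y| ≤ 5 * (A * |(p : ℝ) * y - x * q| + B * (q ^ 2 + y ^ 2)) := by
  wlog hq : 0 ≤ q generalizing p q
  · have := this (-p) (-q) (by linarith)
    rw [defect_lift_neg_left] at this
    push_cast at this
    rwa [show (-p : ℝ) * y - x * -q = -(p * y - x * q) by ring, abs_neg, neg_sq] at this
  wlog hy : 0 ≤ y generalizing x y
  · have := this (-x) (-y) (by linarith)
    rw [defect_lift_neg_right] at this
    push_cast at this
    rwa [show (p : ℝ) * -y - -x * q = -(p * y - x * q) by ring, abs_neg, neg_sq] at this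
  rcases le_total y q with hyq | hyq
  · exact h.defect_le_of_le hA hB hy hyq
  · have := h.defect_le_of_le hA hB (x := p) (p := x) hq hyq
    rw [defect_lift_swap] at this
    rwa [show (x : ℝ) * q - p * y = -(p * y - x * q) by ring, abs_neg, add_comm (_ ^ 2)] at this

/-! ### From the fan bound to a coarse Zygmund bound. -/

/-- `F` is homogeneous of degree `2`. -/
def IsHomogeneousTwo (F : ℤ → ℤ → ℝ) : Prop :=
  ∀ k x y : ℤ, F (k * x) (k * y) = (k : ℝ) ^ 2 * F x y

/-- The Cesàro bound in terms of a potential `F` of the edge function: the parallelogram law for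
`F` holds up to `C * N` at `u`, `N • v`, for every basis `u`, `v` of the integer lattice. -/
def FanBound (C : ℝ) (F : ℤ → ℤ → ℝ) : Prop :=
  ∀ a b c d : ℤ, |a * d - b * c| = 1 → ∀ N : ℤ, 1 ≤ N →
    |F (a + N * c) (b + N * d) + F (a - N * c) (b - N * d) - 2 * F a b - 2 * N ^ 2 * F c d| ≤ C * N

theorem FanBound.nonneg {C : ℝ} {F : ℤ → ℤ → ℝ} (h : FanBound C F) : 0 ≤ C := by
  have := (abs_nonneg _).trans (h 1 0 0 1 (by norm_num) 1 le_rfl)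
  simpa using this

theorem IsHomogeneousTwo.comp {F : ℤ → ℤ → ℝ} (h : IsHomogeneousTwo F) (α β γ δ : ℤ)
    (e f g : ℝ) : IsHomogeneousTwo fun x y =>
      F (α * x + β * y) (γ * x + δ * y) - (e * x ^ 2 + f * x * y + g * y ^ 2) := by
  intro k x y
  have := h k (α * x + β * y) (γ * x + δ * y)
  beta_reduce
  rw [show α * (k * x) + β * (k * y) = k * (α * x + β * y) by ring,
    show γ * (k * x) + δ * (k * y) = k * (γ * x + δ * y) by ring, this]
  push_cast; ring

/-- Unimodular substitutions carry bases to bases, and a quadratic form contributes nothing to the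
left-hand side. -/
theorem FanBound.comp {C : ℝ} {F : ℤ → ℤ → ℝ} (h : FanBound C F) {α β γ δ : ℤ}
    (hdet : |α * δ - β * γ| = 1) (e f g : ℝ) : FanBound C fun x y =>
      F (α * x + β * y) (γ * x + δ * y) - (e * x ^ 2 + f * x * y + g * y ^ 2) := by
  intro a b c d hd N hN
  have := h (α * a + β * b) (γ * a + δ * b) (α * c + β * d) (γ * c + δ * d) (by
    rw [show (α * a + β * b) * (γ * c + δ * d) - (γ * a + δ * b) * (α * c + β * d) =
      (α * δ - β * γ) * (a * d - b * c) by ring, abs_mul, hdet, hd, one_mul]) N hN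
  beta_reduce
  rw [show α * (a + N * c) + β * (b + N * d) = α * a + β * b + N * (α * c + β * d) by ring,
    show γ * (a + N * c) + δ * (b + N * d) = γ * a + δ * b + N * (γ * c + δ * d) by ring,
    show α * (a - N * c) + β * (b - N * d) = α * a + β * b - N * (α * c + β * d) by ring,
    show γ * (a - N * c) + δ * (b - N * d) = γ * a + δ * b - N * (γ * c + δ * d) by ring]
  refine (le_of_eq ?_).trans this
  congr 1
  push_cast; ring

/-- The case `N = 1` in the fan with tip `(0, 1)` bounds the second differences of `n ↦ F 1 n` by
`C`; sum twice. -/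
theorem FanBound.abs_one_le {C : ℝ} {F : ℤ → ℤ → ℝ} (h : FanBound C F) (h10 : F 1 0 = 0)
    (h01 : F 0 1 = 0) (h11 : F 1 1 = 0) (j : ℕ) :
    |F 1 ((j : ℤ) + 1) - F 1 j| ≤ C * j ∧ |F 1 ((j : ℤ) + 1)| ≤ C * (j * (j + 1) / 2) := by
  induction j with
  | zero => simp [h10, h11]
  | succ j ih =>
    have := h 1 ((j : ℤ) + 1) 0 1 (by norm_num) 1 le_rfl
    simp only [mul_zero, add_zero, sub_zero, add_sub_cancel_right, h01, Int.cast_one,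
      mul_one] at this
    push_cast
    rw [abs_le] at *
    obtain ⟨⟨h1, h2⟩, h3⟩ := ih
    rw [abs_le] at *
    constructor <;> constructor <;> linarith

/-- Euclidean descent. With `n = m * j + r`, the vector `(m, n)` lies in the cone of `(1, j)` and
`(1, j + 1)`. Subtracting the quadratic form that agrees with `F` at these two vectors and at `(0,
1)` restores the hypotheses with `m` in place of `n`. Since `j ≥ 2`, the remainder takes a quarter
of the bound and the form three quarters. -/
theorem FanBound.abs_le_sq {C : ℝ} (n : ℕ) : ∀ {F : ℤ → ℤ → ℝ}, FanBound C F → IsHomogeneousTwo F →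
    F 1 0 = 0 → F 0 1 = 0 → F 1 1 = 0 → ∀ m : ℤ, 0 ≤ m → m ≤ n → |F m n| ≤ C * (n : ℝ) ^ 2 := by
  induction n using Nat.strong_induction_on with
  | _ n ih =>
  intro F h hF h10 h01 h11 m hm0 hmn
  -- The substitution `m ↦ n - m` exchanges `(0, 1)` and `(1, 1)`; it secures a quotient of at least
  -- `2`.
  wlog hm : 2 * m ≤ n generalizing F m
  · have := this (h.comp (α := -1) (β := 1) (γ := 0) (δ := 1) (by norm_num) 0 0 0)
      (hF.comp _ _ _ _ _ _ _) (by simpa [h10] using hF (-1) 1 0) (by simp [h11]) (by simp [h01])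
      (n - m) (by lia) (by lia) (by lia)
    simpa using this
  have hC := h.nonneg
  rcases hm0.eq_or_lt with rfl | hm0
  · have := hF n 0 1
    rw [mul_zero, mul_one, h01, mul_zero] at this
    rw [this, abs_zero]
    positivity
  lift m to ℕ using hm0.le
  have hm0 : 0 < m := by exact_mod_cast hm0
  have hj : 2 ≤ n / m := (Nat.le_div_iff_mul_le hm0).2 (by exact_mod_cast hm)
  have hr : n % m < m := Nat.mod_lt _ hm0
  have hn : m * (n / m) + n % m = n := Nat.div_add_mod n m
  generalize n / m = j at hj hn
  generalize n % m = r at hr hn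
  obtain ⟨i, rfl⟩ : ∃ i, j = i + 1 := ⟨j - 1, by lia⟩
  have f1 := (h.abs_one_le h10 h01 h11 i).2
  have f2 := (h.abs_one_le h10 h01 h11 (i + 1)).2
  push_cast at f1 f2
  -- The new basis is `(0, -1)`, `(1, i + 2)`, with sum `(1, i + 1)`; in it `(m, n)` has coordinates
  -- `(m - r, m)`.
  have := ih m (by lia) (h.comp (α := 0) (β := 1) (γ := -1) (δ := i + 1 + 1) (by norm_num)
      0 (F 1 (i + 1) - F 1 (i + 1 + 1)) (F 1 (i + 1 + 1)))
    (hF.comp _ _ _ _ _ _ _) ?_ ?_ ?_ (m - r) (by lia) (by lia)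
  · simp only [zero_mul, one_mul, zero_add, neg_mul] at this
    rw [show -((m : ℤ) - r) + (i + 1 + 1) * m = n by push_cast [← hn]; ring] at this
    have hnR : (n : ℝ) = m * (i + 1) + r := by rw [← hn]; push_cast; ring
    have hr0 : (0 : ℝ) ≤ r := by positivity
    have hmr : (0 : ℝ) ≤ m - r := by
      have : (r : ℝ) ≤ m := by exact_mod_cast hr.le
      linarith
    have hm0' : (0 : ℝ) ≤ m := by positivity
    have hi : (1 : ℝ) ≤ i := by exact_mod_cast (by lia : 1 ≤ i)
    set f := F 1 (i + 1)
    set g := F 1 (i + 1 + 1)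
    have hQ : |(m : ℝ) * ((m - r) * f + r * g)| ≤ 3 / 4 * (C * (m * (i + 1)) ^ 2) := by
      rw [abs_mul, abs_of_nonneg hm0']
      have hf : |f| ≤ 3 / 4 * (C * (i + 1) ^ 2) := by
        refine f1.trans ?_
        have : 0 ≤ C * (((i : ℝ) + 1) * (i + 3)) := by positivity
        nlinarith
      have hg : |g| ≤ 3 / 4 * (C * (i + 1) ^ 2) := by
        refine f2.trans ?_
        have : 0 ≤ C * (((i : ℝ) + 1) * (i - 1)) :=
          mul_nonneg hC (mul_nonneg (by positivity) (by linarith))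
        nlinarith
      calc (m : ℝ) * |(m - r) * f + r * g|
          ≤ m * ((m - r) * (3 / 4 * (C * (i + 1) ^ 2)) + r * (3 / 4 * (C * (i + 1) ^ 2))) := by
            gcongr
            refine (abs_add_le _ _).trans ?_
            rw [abs_mul, abs_mul, abs_of_nonneg hmr, abs_of_nonneg hr0]
            gcongr
        _ = _ := by ring
    have hm4 : C * (m : ℝ) ^ 2 ≤ 1 / 4 * (C * (m * (i + 1)) ^ 2) := by
      have : 0 ≤ C * (m : ℝ) ^ 2 * ((i + 3) * (i - 1)) :=
        mul_nonneg (by positivity) (mul_nonneg (by positivity) (by linarith))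
      nlinarith
    have hle : C * (m * ((i : ℝ) + 1)) ^ 2 ≤ C * (n : ℝ) ^ 2 := by
      rw [hnR]
      gcongr
      linarith
    have e : F m n = (F m n - (0 * (((m : ℤ) - r : ℤ) : ℝ) ^ 2 + (f - g) * ((m : ℤ) - r : ℤ) *
        ((m : ℤ) : ℝ) + g * ((m : ℤ) : ℝ) ^ 2)) + m * ((m - r) * f + r * g) := by
      push_cast; ring
    push_cast at this e
    rw [e]
    refine (abs_add_le _ _).trans ?_
    rw [zero_mul, zero_add] at *
    linarith
  · simpa [h01] using hF (-1) 0 1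
  · simp
  · simp

theorem isHomogeneousTwo_lift (V : ℚ → ℝ) : IsHomogeneousTwo fun x y => lift V x y := by
  intro k x y
  have := lift_mul V k x y
  push_cast at this ⊢
  exact this

theorem lift_one_right (V : ℚ → ℝ) (x : ℚ) : lift V x 1 = V x := by simp [lift]

theorem abs_sub_interpolation_le {C : ℝ} {V : ℚ → ℝ} (h : FanBound C fun x y => lift V x y)
    (n : ℤ) {x : ℚ} (h0 : n ≤ x) (h1 : x ≤ n + 1) :
    |V x - ((n + 1 - x) * V n + (x - n) * V (n + 1))| ≤ C := by
  have hd : (0 : ℚ) < x.den := by exact_mod_cast x.pos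
  have hdR : (0 : ℝ) < x.den := by exact_mod_cast x.pos
  have hx : (x.num : ℚ) = x * x.den := (Rat.mul_den_eq_num x).symm
  have hxR : (x.num : ℝ) = x * x.den := by exact_mod_cast congrArg (Rat.cast : ℚ → ℝ) hx
  have := FanBound.abs_le_sq x.den (h.comp (α := 1) (β := n) (γ := 0) (δ := 1) (by norm_num)
    0 (V (n + 1) - V n) (V n)) ((isHomogeneousTwo_lift V).comp _ _ _ _ _ _ _)
    (by simp [lift_zero_right]) (by simp [lift_one_right])
    (by simp [lift_one_right, add_comm]) (x.num - n * x.den) ?_ ?_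
  · push_cast at this
    rw [one_mul, one_mul, zero_mul, zero_mul, zero_add, zero_add, sub_add_cancel] at this
    simp only [lift, Rat.num_div_den] at this
    rw [hxR] at this
    push_cast at this
    rw [show (x.den : ℝ) ^ 2 * V x - ((V (n + 1) - V n) * (x * x.den - n * x.den) * x.den +
      V n * x.den ^ 2) = (x.den : ℝ) ^ 2 * (V x - ((n + 1 - x) * V n + (x - n) * V (n + 1))) by
      ring, abs_mul, abs_of_nonneg (by positivity), mul_comm] at this
    exact le_of_mul_le_mul_right this (by positivity)
  · have : (0 : ℚ) ≤ x.num - n * x.den := by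
      rw [hx, ← sub_mul]; exact mul_nonneg (by linarith) hd.le
    exact_mod_cast this
  · have : (x.num - n * x.den : ℚ) ≤ x.den := by
      rw [hx, ← sub_mul]; nlinarith
    exact_mod_cast this

/-- On the integers, the fan at `∞` bounds second differences, so `V` stays within `C * M` of an
affine `L` on a window of length `2 * M`; non-integers cost a further `C`. As `L` has no second
difference, the total is `4 * (C * M + C)`, and `M ≤ t + 2`. -/
theorem FanBound.coarseZygmund {C : ℝ} {V : ℚ → ℝ} (h : FanBound C fun x y => lift V x y) :
    CoarseZygmund (4 * C) (12 * C) V := by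
  intro x t ht
  have hC := h.nonneg
  -- The extra `1` places `x - t`, `x` and `x + t` inside the window `[a, a + 2 * M)`.
  set M : ℤ := ⌈t⌉ + 1 with hM
  set a : ℤ := ⌊x⌋ - M with ha
  have hM1 : 2 ≤ M := by
    have : 0 < ⌈t⌉ := Int.ceil_pos.2 ht
    lia
  have hM0 : (0 : ℝ) < M := by exact_mod_cast (by lia : 0 < M)
  -- the affine function which agrees with `V` at `a` and `a + 2 * M`
  set L : ℝ → ℝ := fun y => V a + (y - a) * ((V (a + 2 * M) - V a) / (2 * M)) with hL
  have hint : ∀ j : ℤ, 0 ≤ j → j ≤ 2 * M → |V (a + j) - L (a + j)| ≤ C * M := by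
    intro j hj0 hj1
    have := abs_le_of_second_difference_le (g := fun j : ℤ => V (a + j) - L (a + j))
      (n := 2 * M) (A := C) (B := 0) hC le_rfl (by simp [hL]) ?_ ?_ hj0 hj1
    · refine this.trans (le_of_eq ?_)
      push_cast; ring
    · simp only [hL]
      push_cast
      field_simp
      ring
    · intro i k hk
      have := h (a + i) 1 1 0 (by norm_num) k hk
      simp only [mul_one, mul_zero, add_zero, sub_zero] at this
      push_cast at this
      rw [lift_one_right, lift_one_right, lift_one_right, lift_zero_right] at this
      simp only [hL]
      push_cast
      refine (le_of_eq ?_).trans (this.trans (by simp))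
      congr 1
      rw [add_assoc, add_sub_assoc]
      ring_nf
  have hrat : ∀ y : ℚ, (a : ℚ) ≤ y → y < a + 2 * M → |V y - L y| ≤ C * M + C := by
    intro y hy0 hy1
    have h1 := Int.floor_le y
    have h2 := (Int.lt_floor_add_one y).le
    have e := abs_sub_interpolation_le h ⌊y⌋ h1 h2
    have h3 : a ≤ ⌊y⌋ := Int.le_floor.2 hy0
    have h4 : ⌊y⌋ < a + 2 * M := Int.floor_lt.2 (by push_cast; exact hy1)
    have g1 := hint (⌊y⌋ - a) (by lia) (by lia)
    have g2 := hint (⌊y⌋ + 1 - a) (by lia) (by lia)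
    push_cast at g1 g2
    rw [add_sub_cancel, add_sub_cancel] at g1 g2
    have h1R : ((⌊y⌋ : ℤ) : ℝ) ≤ y := by exact_mod_cast h1
    have h2R : (y : ℝ) ≤ (⌊y⌋ : ℤ) + 1 := by exact_mod_cast h2
    set n : ℤ := ⌊y⌋
    have hLy : L y = (n + 1 - y) * L n + (y - n) * L (n + 1) := by simp only [hL]; ring
    have e2 : V y - L y = (V y - ((n + 1 - y) * V n + (y - n) * V (n + 1))) +
        ((n + 1 - y) * (V n - L n) + (y - n) * (V (n + 1) - L (n + 1))) := by
      rw [hLy]; ring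
    have e3 : |(n + 1 - y) * (V n - L n) + (y - n) * (V (n + 1) - L (n + 1))| ≤ C * M := by
      refine (abs_add_le _ _).trans ?_
      rw [abs_mul, abs_mul, abs_of_nonneg (sub_nonneg.2 h2R), abs_of_nonneg (sub_nonneg.2 h1R)]
      calc _ ≤ (n + 1 - y) * (C * M) + (y - n) * (C * M) := by
            gcongr
        _ = C * M := by ring
    rw [e2]
    refine (abs_add_le _ _).trans ?_
    linarith
  have hfl := Int.floor_le x
  have hfu := Int.lt_floor_add_one x
  have htc := Int.le_ceil t
  have haQ : (a : ℚ) = ⌊x⌋ - M := by rw [ha]; push_cast; ring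
  have hMQ : (M : ℚ) = ⌈t⌉ + 1 := by rw [hM]; push_cast; ring
  have k1 := hrat (x + t) (by linarith) (by linarith)
  have k2 := hrat (x - t) (by linarith) (by linarith)
  have k3 := hrat x (by linarith) (by linarith)
  have hMt : (M : ℝ) ≤ t + 2 := by
    have : (M : ℚ) ≤ t + 2 := by
      have := (Int.ceil_lt_add_one t).le
      linarith
    exact_mod_cast this
  have hsum : L (x + t : ℚ) + L (x - t : ℚ) - 2 * L x = 0 := by
    simp only [hL]; push_cast; ring
  have hCM : C * M ≤ C * (t + 2) := by gcongr
  rw [abs_le] at k1 k2 k3 ⊢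
  constructor <;> linarith [k1.1, k1.2, k2.1, k2.2, k3.1, k3.2]

/-! ### Removing the additive error by a modular substitution. -/

/-- For `z = x + i t` this says that `(r z + s) / (p z + q)` has imaginary part `t / |p z + q|²` at
least `1/2`. Dirichlet approximation with denominators up to about `t ^ (-1/2)` makes each square at
most `t`. -/
theorem exists_int_sq_add_sq_le {x t : ℚ} (ht : 0 < t) :
    ∃ p q r s : ℤ, r * q - s * p = 1 ∧ (p * x + q) ^ 2 + (p * t) ^ 2 ≤ 2 * t := by
  -- Dividing by the gcd only decreases the left-hand side, and Bézout completes the matrix.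
  suffices ∃ p q : ℤ, (p ≠ 0 ∨ q ≠ 0) ∧ (p * x + q) ^ 2 + (p * t) ^ 2 ≤ 2 * t by
    obtain ⟨p, q, hpq, h⟩ := this
    have hg : 0 < Int.gcd p q := Int.gcd_pos_iff.2 hpq
    obtain ⟨p', q', hco, hp, hq⟩ := Int.exists_gcd_one hg
    have hb := Int.gcd_eq_gcd_ab p' q'
    rw [hco] at hb
    refine ⟨p', q', Int.gcdB p' q', -Int.gcdA p' q', ?_, ?_⟩
    · push_cast at hb
      linarith
    · refine le_trans ?_ h
      generalize Int.gcd p q = g at *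
      have hg1 : (1 : ℚ) ≤ (g : ℚ) ^ 2 := by exact_mod_cast Nat.one_le_pow _ _ hg
      have : 0 ≤ (p' * x + q') ^ 2 + (p' * t) ^ 2 := by positivity
      rw [hp, hq]
      push_cast
      nlinarith
  rcases le_or_gt 1 t with h1 | h1
  · exact ⟨0, 1, by norm_num, by norm_num; linarith⟩
  · set n := Nat.sqrt ⌊1 / t⌋₊ with hn
    have h1t : 1 ≤ 1 / t := (one_le_div ht).2 h1.le
    have hfl : 1 ≤ ⌊1 / t⌋₊ := Nat.le_floor (by exact_mod_cast h1t)
    have hn0 : 0 < n := Nat.sqrt_pos.2 hfl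
    have hn1 : (n : ℚ) ^ 2 * t ≤ 1 := by
      have : ((n ^ 2 : ℕ) : ℚ) ≤ 1 / t :=
        (Nat.cast_le.2 (Nat.sqrt_le' _)).trans (Nat.floor_le (by positivity))
      rw [le_div_iff₀ ht] at this
      exact_mod_cast this
    have hn2 : 1 ≤ ((n : ℚ) + 1) ^ 2 * t := by
      have h : ⌊1 / t⌋₊ < (n + 1) ^ 2 := Nat.lt_succ_sqrt' _
      have := (Nat.floor_lt (by positivity)).1 h
      rw [div_lt_iff₀ ht] at this
      push_cast at this
      exact this.le
    obtain ⟨j, k, hk0, hkn, hjk⟩ := Real.exists_int_int_abs_mul_sub_le x hn0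
    refine ⟨k, -j, Or.inl hk0.ne', ?_⟩
    have hjk' : |(k : ℚ) * x - j| ≤ 1 / (n + 1) := by
      rw [← Rat.cast_le (K := ℝ)]
      push_cast
      exact hjk
    have e1 : ((k : ℚ) * x - j) ^ 2 ≤ t := by
      rw [← sq_abs]
      calc |(k : ℚ) * x - j| ^ 2 ≤ (1 / (n + 1)) ^ 2 := by gcongr
        _ ≤ t := by
          rw [div_pow, one_pow, div_le_iff₀ (by positivity)]; linarith
    have e2 : ((k : ℚ) * t) ^ 2 ≤ t := by
      have hk : (k : ℚ) ≤ n := by exact_mod_cast hkn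
      have hk0 : (0 : ℚ) ≤ k := by exact_mod_cast hk0.le
      calc ((k : ℚ) * t) ^ 2 ≤ (n * t) ^ 2 := by gcongr
        _ = (n ^ 2 * t) * t := by ring
        _ ≤ 1 * t := by gcongr
        _ = t := one_mul t
    push_cast
    rw [← sub_eq_add_neg]
    linarith

/-- The second difference of `V` at `x`, `t` is the defect at `(x, 1)`, `(t, 0)`. After the
substitution the coarse bound reads `5 * (4 * C * t + 12 * C * (2 * t)) = 140 * C * t`. -/
theorem FanBound.zygmund {C : ℝ} {V : ℚ → ℝ} (h : FanBound C fun x y => lift V x y) :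
    CoarseZygmund (140 * C) 0 V := by
  intro x t ht
  have hC := h.nonneg
  obtain ⟨p, q, r, s, hdet, hpq⟩ := exists_int_sq_add_sq_le (x := x) ht
  -- Lifts vanish at `(1, 0)`, so the transported lift is a lift only after subtracting its value
  -- there times `x ^ 2`.
  set e := lift V q (-p) with he
  set W : ℚ → ℝ := fun z => lift V (q * z - s) (-p * z + r) - e * z ^ 2 with hW
  have hlift : ∀ x y : ℚ, lift W x y = lift V (q * x - s * y) (-p * x + r * y) - e * x ^ 2 := by
    intro x y
    rcases eq_or_ne y 0 with rfl | hy
    · have := lift_mul V x q (-p)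
      rw [lift_zero_right, mul_zero, mul_zero, sub_zero, add_zero, mul_comm _ x, mul_comm _ x,
        this]
      ring
    · have := lift_mul V y (q * (x / y) - s) (-p * (x / y) + r)
      rw [lift, hW]
      beta_reduce
      have hyR : (y : ℝ) ≠ 0 := by exact_mod_cast hy
      rw [mul_sub, ← this, show y * (q * (x / y) - s) = q * x - s * y by field_simp,
        show y * (-p * (x / y) + r) = -p * x + r * y by field_simp]
      push_cast
      field_simp
  have hWF : FanBound C fun x y => lift W x y := by
    have := h.comp (α := q) (β := -s) (γ := -p) (δ := r)
      (by rw [show q * r - -s * -p = 1 by linarith, abs_one]) e 0 0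
    convert this using 3
    rw [hlift]
    push_cast
    ring_nf
  have hdetQ : (r * q - s * p : ℚ) = 1 := by exact_mod_cast hdet
  have := hWF.coarseZygmund.defect_le (by positivity) (by positivity)
    (r * x + s) (p * x + q) (r * t) (p * t)
  have hD : defect (lift W) (r * x + s) (p * x + q) (r * t) (p * t) =
      V (x + t) + V (x - t) - 2 * V x := by
    simp only [defect, hlift]
    rw [show q * (r * x + s + r * t) - s * (p * x + q + p * t) = (r * q - s * p) * (x + t) by ring,
      show -p * (r * x + s + r * t) + r * (p * x + q + p * t) = r * q - s * p by ring,
      show q * (r * x + s - r * t) - s * (p * x + q - p * t) = (r * q - s * p) * (x - t) by ring,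
      show -p * (r * x + s - r * t) + r * (p * x + q - p * t) = r * q - s * p by ring,
      show q * (r * x + s) - s * (p * x + q) = (r * q - s * p) * x by ring,
      show -p * (r * x + s) + r * (p * x + q) = r * q - s * p by ring,
      show q * (r * t) - s * (p * t) = (r * q - s * p) * t by ring,
      show -p * (r * t) + r * (p * t) = 0 by ring, hdetQ]
    simp only [one_mul, lift_one_right, lift_zero_right]
    push_cast
    ring
  rw [hD] at this
  have hdet' : ((r * x + s : ℚ) : ℝ) * (p * t : ℚ) - (r * t : ℚ) * (p * x + q : ℚ) = -t := by
    have : (r * x + s) * (p * t) - (r * t) * (p * x + q) = -((r * q - s * p) * t) := by ring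
    rw [hdetQ, one_mul] at this
    exact_mod_cast this
  have htR : (0 : ℝ) < t := by exact_mod_cast ht
  rw [hdet', abs_neg, abs_of_pos htR] at this
  have hpqR : ((p * x + q : ℚ) : ℝ) ^ 2 + (p * t : ℚ) ^ 2 ≤ 2 * t := by exact_mod_cast hpq
  have : 12 * C * (((p * x + q : ℚ) : ℝ) ^ 2 + (p * t : ℚ) ^ 2) ≤ 12 * C * (2 * t) := by gcongr
  linarith

/-! ### Extension to the real line, growth at infinity, rigidity. -/

theorem CoarseZygmund.abs_le_of_mem {K : ℝ} {V : ℚ → ℝ} (hK : 0 ≤ K) (h : CoarseZygmund K 0 V)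
    {N : ℕ} (hN : 0 < N) {x : ℚ} (hx : |x| ≤ N) :
    |V x| ≤ |V (-N)| + |V N| + K * N := by
  have hNQ : (0 : ℚ) < N := by exact_mod_cast hN
  have hNR : (0 : ℝ) < N := by exact_mod_cast hN
  rw [_root_.abs_le] at hx
  have h0 : 0 ≤ (x + N) / (2 * N) := div_nonneg (by linarith) (by positivity)
  have h1 : (x + N) / (2 * N) ≤ 1 := (div_le_one (by positivity)).2 (by linarith)
  have := h.interpolation hK le_rfl (a := -N) (b := N) (by linarith) h0 h1
  rw [show -(N : ℚ) + (x + N) / (2 * N) * (N - -N) = x by field_simp; ring] at this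
  generalize (x + N) / (2 * N) = θ at *
  have h0R : (0 : ℝ) ≤ θ := by exact_mod_cast h0
  have h1R : (0 : ℝ) ≤ 1 - θ := sub_nonneg.2 (by exact_mod_cast h1)
  have e : |(1 - (θ : ℝ)) * V (-N) + θ * V N| ≤ |V (-N)| + |V N| := by
    refine (abs_add_le _ _).trans ?_
    rw [abs_mul, abs_mul, abs_of_nonneg h0R, abs_of_nonneg h1R]
    have := abs_nonneg (V (-N))
    have := abs_nonneg (V N)
    nlinarith
  have e2 := abs_add_le (V x - ((1 - (θ : ℝ)) * V (-N) + θ * V N))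
    ((1 - (θ : ℝ)) * V (-N) + θ * V N)
  rw [sub_add_cancel] at e2
  push_cast at this
  linarith

/-- Interpolate between `x` and `x + L`: the error is at most `K * L / 2 < ε / 2`, and the chord has
slope at most `2 * B / L`. -/
theorem CoarseZygmund.uniformly_continuous {K : ℝ} {V : ℚ → ℝ} (hK : 0 ≤ K)
    (h : CoarseZygmund K 0 V) (N : ℕ) {ε : ℝ} (hε : 0 < ε) :
    ∃ δ : ℝ, 0 < δ ∧ ∀ x y : ℚ, |x| ≤ N → |y| ≤ N → |(x : ℝ) - y| < δ → |V x - V y| < ε := by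
  set B := |V (-(N + 1 : ℕ))| + |V (N + 1 : ℕ)| + K * (N + 1 : ℕ) with hB
  have hB0 : 0 ≤ B := by positivity
  obtain ⟨L, hL0, hL⟩ := exists_rat_btwn (show (0 : ℝ) < min 1 (ε / (K + 1)) by positivity)
  have hL1 : (L : ℝ) < 1 := hL.trans_le (min_le_left _ _)
  have hL2 : K * L < ε := by
    have := hL.trans_le (min_le_right _ _)
    rw [lt_div_iff₀ (by positivity)] at this
    linarith
  refine ⟨min L (L * ε / (4 * (B + 1))), by positivity, ?_⟩
  intro x y hx hy hxy
  wlog hlt : x ≤ y generalizing x y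
  · rw [abs_sub_comm]
    exact this y x hy hx (by rwa [abs_sub_comm]) (le_of_not_ge hlt)
  rw [abs_sub_comm, abs_of_nonneg (sub_nonneg.2 (by exact_mod_cast hlt))] at hxy
  have hL0Q : 0 < L := by exact_mod_cast hL0
  have hL1Q : L < 1 := by exact_mod_cast hL1
  have h1 : y - x < L := by exact_mod_cast hxy.trans_le (min_le_left _ _)
  have h2 := hxy.trans_le (min_le_right _ _)
  have hθ0 : 0 ≤ (y - x) / L := div_nonneg (by linarith) hL0Q.le
  have := h.interpolation hK le_rfl (a := x) (b := x + L) (by linarith) hθ0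
    ((div_le_one hL0Q).2 h1.le)
  rw [add_sub_cancel_left, div_mul_cancel₀ _ hL0Q.ne', add_sub_cancel] at this
  rw [_root_.abs_le] at hx hy
  have b1 : |V x| ≤ B := h.abs_le_of_mem hK N.succ_pos (_root_.abs_le.2
    ⟨by push_cast; linarith, by push_cast; linarith⟩)
  have b2 : |V (x + L)| ≤ B := h.abs_le_of_mem hK N.succ_pos (_root_.abs_le.2
    ⟨by push_cast; linarith, by push_cast; linarith⟩)
  have hθ : (((y - x) / L : ℚ) : ℝ) * (2 * B) ≤ ε / 2 := by
    push_cast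
    rw [lt_div_iff₀ (by positivity)] at h2
    have hyx : (0 : ℝ) ≤ y - x := sub_nonneg.2 (by exact_mod_cast hlt)
    rw [div_mul_eq_mul_div, div_le_iff₀ hL0]
    nlinarith
  have hθR : (0 : ℝ) ≤ ((y - x) / L : ℚ) := by exact_mod_cast hθ0
  generalize (y - x) / L = θ at *
  have b3 : |(θ : ℝ) * (V (x + L) - V x)| ≤ θ * (2 * B) := by
    rw [abs_mul, abs_of_nonneg hθR]
    gcongr
    refine (abs_sub _ _).trans ?_
    linarith
  push_cast at this
  rw [_root_.abs_le] at this b3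
  rw [abs_lt]
  constructor <;> linarith [this.1, this.2, b3.1, b3.2]

theorem CoarseZygmund.exists_extension {K : ℝ} {V : ℚ → ℝ} (hK : 0 ≤ K)
    (h : CoarseZygmund K 0 V) : ∃ W : ℝ → ℝ, Continuous W ∧ ∀ q : ℚ, W q = V q := by
  have hd : IsDenseInducing (Rat.cast : ℚ → ℝ) := Rat.isDenseEmbedding_coe_real.isDenseInducing
  have hVc : Continuous V := by
    rw [Metric.continuous_iff]
    intro x ε hε
    obtain ⟨N, hN⟩ := exists_nat_ge (|x| + 1)
    obtain ⟨δ, hδ, hu⟩ := h.uniformly_continuous hK N hε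
    refine ⟨min 1 δ, by positivity, fun y hy => ?_⟩
    rw [Rat.dist_eq] at hy
    have h1 : |y - x| ≤ 1 := by exact_mod_cast hy.le.trans (min_le_left _ _)
    have h2 := abs_add_le (y - x) x
    rw [sub_add_cancel] at h2
    exact hu y x (by linarith) (by linarith) (hy.trans_le (min_le_right _ _))
  refine ⟨hd.extend V, hd.continuous_extend fun x => ?_, fun q => hd.extend_eq hVc q⟩
  apply CompleteSpace.complete
  have hne := hd.comap_nhds_neBot x
  rw [Metric.cauchy_iff]
  refine ⟨Filter.map_neBot, fun ε hε => ?_⟩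
  obtain ⟨N, hN⟩ := exists_nat_ge (|x| + 1)
  obtain ⟨δ, hδ, hu⟩ := h.uniformly_continuous hK N hε
  refine ⟨V '' (Rat.cast ⁻¹' Metric.ball x (min 1 (δ / 2))), Filter.image_mem_map
    (Filter.preimage_mem_comap (Metric.ball_mem_nhds _ (by positivity))), ?_⟩
  have hb : ∀ q : ℚ, (q : ℝ) ∈ Metric.ball x (min 1 (δ / 2)) →
      |q| ≤ N ∧ |(q : ℝ) - x| < δ / 2 := by
    intro q hq
    rw [Metric.mem_ball, Real.dist_eq] at hq
    refine ⟨?_, hq.trans_le (min_le_right _ _)⟩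
    have h1 := hq.le.trans (min_le_left _ _)
    have h2 := abs_add_le (q - x) x
    rw [sub_add_cancel] at h2
    rw [← Rat.cast_le (K := ℝ)]
    push_cast
    linarith
  rintro _ ⟨p, hp, rfl⟩ _ ⟨q, hq, rfl⟩
  obtain ⟨p1, p2⟩ := hb p hp
  obtain ⟨q1, q2⟩ := hb q hq
  refine hu p q p1 q1 ?_
  rw [abs_lt] at *
  constructor <;> linarith [p2.1, p2.2, q2.1, q2.2]

theorem zygmundBounded_of_rat {K : ℝ} {W : ℝ → ℝ} (hW : Continuous W)
    (h : CoarseZygmund K 0 fun q => W q) : ZygmundBounded K W := by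
  have key : ∀ x t : ℝ, |W (x + t) + W (x - t) - 2 * W x| ≤ K * |t| := by
    intro x t
    refine Rat.denseRange_cast.induction_on₂ (p := fun x t : ℝ =>
      |W (x + t) + W (x - t) - 2 * W x| ≤ K * |t|) ?_ ?_ x t
    · exact isClosed_le (by fun_prop) (by fun_prop)
    · intro x t
      rcases lt_trichotomy t 0 with ht | rfl | ht
      · have := h x (-t) (by linarith)
        have ht' : (t : ℝ) < 0 := by exact_mod_cast ht
        rw [abs_of_neg ht']
        push_cast at this
        rw [sub_neg_eq_add, ← sub_eq_add_neg, add_comm (W _), add_zero] at this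
        exact this
      · simp [← two_mul]
      · have := h x t ht
        have ht' : (0 : ℝ) < t := by exact_mod_cast ht
        rw [abs_of_pos ht']
        push_cast at this
        simpa using this
  intro x t ht
  simpa [abs_of_pos ht] using key x t

theorem ZygmundBounded.coarseZygmund {K : ℝ} {W : ℝ → ℝ} (h : ZygmundBounded K W) :
    CoarseZygmund K 0 fun q => W q := by
  intro x t ht
  have := h x t (by exact_mod_cast ht)
  push_cast
  simpa using this

theorem ZygmundBounded.nonneg {K : ℝ} {W : ℝ → ℝ} (h : ZygmundBounded K W) : 0 ≤ K := by
  simpa using (abs_nonneg _).trans (h 0 1 one_pos)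

/-- Since `W 0 = 0`, doubling the argument doubles `W` up to `K * |y|`; over the dyadic scales this
adds up to the logarithm. The induction step uses `1 ≤ 2 * log 2`. -/
theorem ZygmundBounded.vanish_infty {K : ℝ} {W : ℝ → ℝ} (hW : Continuous W)
    (h : ZygmundBounded K W) (h0 : W 0 = 0) :
    W =O[Filter.atBot ⊔ Filter.atTop] fun x : ℝ => |x| * Real.log |x| := by
  have hK := h.nonneg
  obtain ⟨B, hB⟩ := (isCompact_Icc (a := (-2 : ℝ)) (b := 2)).exists_bound_of_continuousOn
    hW.continuousOn
  have hB0 : 0 ≤ B := (norm_nonneg _).trans (hB 0 (by norm_num))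
  have hz : ∀ y : ℝ, |W (2 * y)| ≤ 2 * |W y| + K * |y| := by
    intro y
    have key : |W (2 * y) + W 0 - 2 * W y| ≤ K * |y| := by
      rcases lt_trichotomy y 0 with hy | rfl | hy
      · have := h y (-y) (by linarith)
        rwa [add_neg_cancel, sub_neg_eq_add, ← two_mul, add_comm (W 0), ← abs_of_neg hy] at this
      · simp [h0]
      · have := h y y hy
        rw [sub_self, ← two_mul] at this
        rwa [abs_of_pos hy]
    have := abs_add_le (W (2 * y) + W 0 - 2 * W y) (2 * W y)
    rw [h0, add_zero, sub_add_cancel, abs_mul, abs_two] at this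
    rw [h0, add_zero] at key
    linarith
  have hn : ∀ n : ℕ, ∀ x : ℝ, 1 ≤ |x| → |x| ≤ 2 ^ n →
      |W x| ≤ |x| * (B + K * Real.log |x|) := by
    intro n
    induction n with
    | zero =>
      intro x h1 h2
      have hx2 : |x| ≤ 2 := by rw [pow_zero] at h2; linarith
      have := hB x (_root_.abs_le.1 hx2)
      rw [Real.norm_eq_abs] at this
      have := Real.log_nonneg h1
      have : 0 ≤ K * Real.log |x| := by positivity
      nlinarith
    | succ n ih =>
      intro x h1 h2
      rcases le_or_gt |x| 2 with hx2 | hx2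
      · have := hB x (_root_.abs_le.1 hx2)
        rw [Real.norm_eq_abs] at this
        have := Real.log_nonneg h1
        have : 0 ≤ K * Real.log |x| := by positivity
        nlinarith
      · obtain ⟨y, rfl⟩ : ∃ y, x = 2 * y := ⟨x / 2, by ring⟩
        rw [abs_mul, abs_two] at *
        rw [pow_succ] at h2
        have hy := ih y (by linarith) (by linarith)
        have hy0 : 0 < |y| := by linarith
        rw [Real.log_mul two_ne_zero hy0.ne']
        have h3 := hz y
        have h4 := Real.log_two_gt_d9
        have h5 : K * |y| ≤ K * |y| * (2 * Real.log 2) :=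
          le_mul_of_one_le_right (by positivity) (by linarith)
        linarith
  refine Asymptotics.IsBigO.of_bound (B + K) ?_
  have hb : ∀ x : ℝ, 3 ≤ |x| → ‖W x‖ ≤ (B + K) * ‖|x| * Real.log |x|‖ := by
    intro x hx
    obtain ⟨n, hn'⟩ := pow_unbounded_of_one_lt |x| one_lt_two
    have h1 := hn n x (by linarith) hn'.le
    have hlog : 1 ≤ Real.log |x| := by
      rw [Real.le_log_iff_exp_le (by linarith)]
      have := Real.exp_one_lt_d9
      linarith
    rw [Real.norm_eq_abs, Real.norm_eq_abs,
      abs_of_nonneg (mul_nonneg (abs_nonneg x) (by linarith))]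
    have : |x| * B ≤ |x| * B * Real.log |x| := le_mul_of_one_le_right (by positivity) hlog
    linarith
  rw [Filter.eventually_sup]
  constructor
  · filter_upwards [Filter.eventually_le_atBot (-3)] with x hx
    exact hb x (by rw [abs_of_neg (by linarith)]; linarith)
  · filter_upwards [Filter.eventually_ge_atTop 3] with x hx
    exact hb x (by rw [abs_of_pos (by linarith)]; linarith)

/-- With constant `0` interpolation is exact, so `W` is affine on the rationals. -/
theorem ZygmundBounded.eq_zero {W : ℝ → ℝ} (hW : Continuous W) (h : ZygmundBounded 0 W)
    (h0 : W 0 = 0) (h1 : W 1 = 0) : W = 0 := by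
  have hpos : ∀ x : ℚ, 0 < x → W x = 0 := by
    intro x hx
    rcases le_total 1 x with h1x | h1x
    · have := h.coarseZygmund.interpolation le_rfl le_rfl hx (θ := 1 / x) (by positivity)
        ((div_le_one hx).2 h1x)
      have hxR : (x : ℝ) ≠ 0 := by exact_mod_cast hx.ne'
      have hle : |(x : ℝ)|⁻¹ * |W x| ≤ 0 := by simpa [h0, h1, hx.ne', hxR] using this
      by_contra hne
      have : 0 < |(x : ℝ)|⁻¹ * |W x| := by positivity
      linarith
    · have := h.coarseZygmund.interpolation le_rfl le_rfl zero_lt_one (θ := x) hx.le h1x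
      simpa [h0, h1] using this
  have hall : ∀ x : ℚ, W x = 0 := by
    intro x
    rcases lt_trichotomy x 0 with hx | rfl | hx
    · have := h 0 (-x) (by have : (x : ℝ) < 0 := by exact_mod_cast hx
                           linarith)
      have h2 := hpos (-x) (by linarith)
      push_cast at h2
      simpa [h0, h2] using this
    · simpa using h0
    · exact hpos x hx
  exact Rat.denseRange_cast.equalizer hW continuous_zero (funext hall)

/-! ### The Farey tessellation in homogeneous coordinates. -/

/-- The point of `ℚ ∪ {∞}` with homogeneous coordinates `(x, y)`. -/
def pt (x y : ℤ) : OnePoint ℚ := if y = 0 then ∞ else ((x / y : ℚ) : OnePoint ℚ)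

/-- The factor between `(x, y)` and the homogeneous coordinates used in `diff`. -/
def scale (x y : ℤ) : ℤ := if y = 0 then x else y

theorem pt_neg (x y : ℤ) : pt (-x) (-y) = pt x y := by
  simp only [pt, neg_eq_zero, Int.cast_neg, neg_div_neg_eq]

theorem scale_ne_zero {x y : ℤ} (h : IsCoprime x y) : scale x y ≠ 0 := by
  unfold scale
  split_ifs with hy
  · rintro rfl
    subst hy
    exact not_isCoprime_zero_zero h
  · exact hy

theorem diff_coe (x y : ℚ) : diff (x : OnePoint ℚ) y = x - y := rfl

theorem diff_infty_coe (y : ℚ) : diff ∞ (y : OnePoint ℚ) = 1 := rfl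

theorem diff_coe_infty (y : ℚ) : diff (y : OnePoint ℚ) ∞ = -1 := rfl

theorem diff_infty_infty : diff (∞ : OnePoint ℚ) ∞ = 0 := rfl

/-- Differences become determinants; the scale factors cancel in cross-ratios and occur squared in
`CyclicPos`. -/
theorem diff_pt {x y z w : ℤ} (h1 : IsCoprime x y) (h2 : IsCoprime z w) :
    diff (pt x y) (pt z w) = (x * w - z * y : ℚ) / (scale x y * scale z w) := by
  have s1 := scale_ne_zero h1
  have s2 := scale_ne_zero h2
  rw [← Int.cast_ne_zero (α := ℚ)] at s1 s2
  unfold scale pt at *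
  split_ifs at * with hy hw hw
  · simp [hy, hw, diff_infty_infty]
  · rw [diff_infty_coe, hy]
    field_simp
    simp
  · rw [diff_coe_infty, hw]
    field_simp
    simp
  · rw [diff_coe]
    field_simp

theorem exists_eq_pt (p : OnePoint ℚ) : ∃ x y : ℤ, IsCoprime x y ∧ p = pt x y := by
  induction p using OnePoint.rec with
  | infty => exact ⟨1, 0, isCoprime_one_left, by simp [pt]⟩
  | coe q => exact ⟨q.num, q.den, q.isCoprime_num_den, by simp [pt, Rat.num_div_den]⟩

theorem num_den_pt {x y : ℤ} (h : IsCoprime x y) :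
    (num (pt x y) = x ∧ den (pt x y) = y) ∨ (num (pt x y) = -x ∧ den (pt x y) = -y) := by
  unfold pt
  split_ifs with hy
  · subst hy
    have : x = 1 ∨ x = -1 := Int.isUnit_iff.1 (isCoprime_zero_right.1 h)
    rcases this with rfl | rfl
    · left; exact ⟨rfl, rfl⟩
    · right; exact ⟨rfl, rfl⟩
  · have e1 : num ((x / y : ℚ) : OnePoint ℚ) = (x / y : ℚ).num := rfl
    have e2 : den ((x / y : ℚ) : OnePoint ℚ) = (x / y : ℚ).den := rfl
    rw [e1, e2]
    rcases lt_or_gt_of_ne hy with hy | hy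
    · right
      have h' : Int.gcd (-x) (-y) = 1 := by
        rw [Int.gcd_neg, Int.neg_gcd]
        exact Int.isCoprime_iff_gcd_eq_one.1 h
      rw [← neg_div_neg_eq]
      have k1 := Rat.num_div_eq_of_coprime (a := -x) (b := -y) (by lia) h'
      have k2 := Rat.den_div_eq_of_coprime (a := -x) (b := -y) (by lia) h'
      push_cast at k1 k2
      exact ⟨k1, k2⟩
    · left
      have h' := Int.isCoprime_iff_gcd_eq_one.1 h
      exact ⟨Rat.num_div_eq_of_coprime hy h', Rat.den_div_eq_of_coprime hy h'⟩

theorem adj_pt {x y z w : ℤ} (h1 : IsCoprime x y) (h2 : IsCoprime z w) :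
    fareyGraph.Adj (pt x y) (pt z w) ↔ |x * w - y * z| = 1 := by
  change |num (pt x y) * den (pt z w) - num (pt z w) * den (pt x y)| = 1 ↔ _
  rw [show x * w - y * z = x * w - z * y by ring]
  rcases num_den_pt h1 with ⟨e1, e2⟩ | ⟨e1, e2⟩ <;>
  rcases num_den_pt h2 with ⟨e3, e4⟩ | ⟨e3, e4⟩ <;> rw [e1, e2, e3, e4]
  · rw [← abs_neg, show -(x * -w - -z * y) = x * w - z * y by ring]
  · rw [← abs_neg, show -(-x * w - z * -y) = x * w - z * y by ring]
  · rw [show -x * -w - -z * -y = x * w - z * y by ring]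

theorem pt_eq_pt {x y z w : ℤ} (h1 : IsCoprime x y) (h2 : IsCoprime z w) (h : pt x y = pt z w) :
    (x = z ∧ y = w) ∨ (x = -z ∧ y = -w) := by
  have h3 := num_den_pt h1
  have h4 := num_den_pt h2
  rw [h] at h3
  lia

theorem isCoprime_left {x y z w : ℤ} (h : |x * w - y * z| = 1) : IsCoprime x y := by
  rcases (abs_eq zero_le_one).1 h with h | h
  · exact ⟨w, -z, by linarith⟩
  · exact ⟨-w, z, by linarith⟩

theorem abs_det_comm {x y z w : ℤ} : |z * y - w * x| = |x * w - y * z| := by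
  rw [← abs_neg]; ring_nf

theorem isCoprime_right {x y z w : ℤ} (h : |x * w - y * z| = 1) : IsCoprime z w := by
  rw [← abs_det_comm] at h
  exact isCoprime_left h

theorem adj_of_abs_det {x y z w : ℤ} (h : |x * w - y * z| = 1) :
    fareyGraph.Adj (pt x y) (pt z w) :=
  (adj_pt (isCoprime_left h) (isCoprime_right h)).2 h

theorem cyclicPos_pt {a b c d e f : ℤ} (h1 : IsCoprime a b) (h2 : IsCoprime c d)
    (h3 : IsCoprime e f) : CyclicPos (pt a b) (pt c d) (pt e f) ↔
      0 < (a * d - c * b) * (c * f - e * d) * (e * b - a * f) := by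
  unfold CyclicPos
  rw [diff_pt h1 h2, diff_pt h2 h3, diff_pt h3 h1]
  have s1 := scale_ne_zero h1
  have s2 := scale_ne_zero h2
  have s3 := scale_ne_zero h3
  rw [← Int.cast_ne_zero (α := ℚ)] at s1 s2 s3
  rw [div_mul_div_comm, div_mul_div_comm, show (scale a b * scale c d * (scale c d * scale e f) *
    (scale e f * scale a b) : ℚ) = (scale a b * scale c d * scale e f) ^ 2 by ring,
    div_pos_iff_of_pos_right (by positivity)]
  norm_cast

/-- The coordinates of `p` in the basis are its two determinants, both `±1`. -/
theorem eq_pt_add_or_sub {x y z w : ℤ} (h : z * y - w * x = 1) {p : OnePoint ℚ}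
    (h1 : fareyGraph.Adj p (pt x y)) (h2 : fareyGraph.Adj p (pt z w)) :
    p = pt (x - z) (y - w) ∨ p = pt (x + z) (y + w) := by
  have hd : |x * w - y * z| = 1 := by
    rw [← abs_neg, show -(x * w - y * z) = 1 by linarith, abs_one]
  obtain ⟨a, b, hab, rfl⟩ := exists_eq_pt p
  rw [adj_pt hab (isCoprime_left hd)] at h1
  rw [adj_pt hab (isCoprime_right hd)] at h2
  have ha : a = (a * y - b * x) * z - (a * w - b * z) * x := by linear_combination (-a) * h
  have hb : b = (a * y - b * x) * w - (a * w - b * z) * y := by linear_combination (-b) * h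
  rcases (abs_eq zero_le_one).1 h1 with h1 | h1 <;>
  rcases (abs_eq zero_le_one).1 h2 with h2 | h2 <;> rw [h1, h2] at ha hb <;> rw [ha, hb]
  · left; rw [← pt_neg]; congr 1 <;> ring
  · right; congr 1 <;> ring
  · right; rw [← pt_neg]; congr 1 <;> ring
  · left; congr 1 <;> ring

theorem isQuad_pt {x y z w : ℤ} (h : z * y - w * x = 1) :
    IsQuad (pt (x - z) (y - w)) (pt x y) (pt (x + z) (y + w)) (pt z w) := by
  have e : x * w = z * y - 1 := by linarith
  have hd : |x * w - y * z| = 1 := by rw [e]; ring_nf; norm_num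
  have h1 : |(x - z) * y - (y - w) * x| = 1 := by ring_nf; ring_nf at e; rw [e]; ring_nf; norm_num
  have h2 : |(x - z) * w - (y - w) * z| = 1 := by ring_nf; ring_nf at e; rw [e]; ring_nf; norm_num
  have h3 : |(x + z) * y - (y + w) * x| = 1 := by ring_nf; ring_nf at e; rw [e]; ring_nf; norm_num
  have h4 : |(x + z) * w - (y + w) * z| = 1 := by ring_nf; ring_nf at e; rw [e]; ring_nf; norm_num
  refine ⟨adj_of_abs_det hd, adj_of_abs_det h1, adj_of_abs_det h2, adj_of_abs_det h3,
    adj_of_abs_det h4, ?_, ?_⟩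
  · rw [cyclicPos_pt (isCoprime_left h1) (isCoprime_left hd) (isCoprime_left h3)]
    have : ((x - z) * y - x * (y - w)) * (x * (y + w) - (x + z) * y) *
      ((x + z) * (y - w) - (x - z) * (y + w)) = 2 * (z * y - w * x) ^ 3 := by ring
    rw [this, h]; norm_num
  · rw [cyclicPos_pt (isCoprime_left h3) (isCoprime_right hd) (isCoprime_left h1)]
    have : ((x + z) * w - z * (y + w)) * (z * (y - w) - (x - z) * w) *
      ((x - z) * (y + w) - (x + z) * (y - w)) = 2 * (z * y - w * x) ^ 3 := by ring
    rw [this, h]; norm_num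

/-- The sign of the vector for `d` fixes the determinant, and the cyclic order then decides which
third vertex is the sum and which the difference. -/
theorem IsQuad.exists_pt {a b c d : OnePoint ℚ} (h : IsQuad a b c d) :
    ∃ x y z w : ℤ, z * y - w * x = 1 ∧ a = pt (x - z) (y - w) ∧ b = pt x y ∧
      c = pt (x + z) (y + w) ∧ d = pt z w := by
  obtain ⟨x, y, hxy, rfl⟩ := exists_eq_pt b
  obtain ⟨z, w, hdet, rfl⟩ : ∃ z w : ℤ, z * y - w * x = 1 ∧ d = pt z w := by
    obtain ⟨z, w, hzw, rfl⟩ := exists_eq_pt d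
    have := (adj_pt hxy hzw).1 h.diag
    rcases (abs_eq zero_le_one).1 this with h | h
    · exact ⟨-z, -w, by linarith, (pt_neg z w).symm⟩
    · exact ⟨z, w, by linarith, rfl⟩
  refine ⟨x, y, z, w, hdet, ?_, rfl, ?_, rfl⟩
  all_goals
    have hq := isQuad_pt hdet
    have hpos := h.pos_abc
    have hirr : ∀ p q, ¬ CyclicPos p q p := fun p q => by
      unfold CyclicPos
      have : diff p p = 0 := by induction p using OnePoint.rec <;> simp [diff]
      simp [this]
    have hneg : ∀ p q r, CyclicPos p q r → ¬ CyclicPos r q p := fun p q r h1 h2 => by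
      unfold CyclicPos at h1 h2
      have hs : ∀ u v : OnePoint ℚ, diff u v = -diff v u := fun u v => by
        induction u using OnePoint.rec <;> induction v using OnePoint.rec <;> simp [diff]
      rw [hs r q, hs q p, hs p r] at h2
      linarith
    rcases eq_pt_add_or_sub hdet h.ab h.ad with ha | ha <;>
    rcases eq_pt_add_or_sub hdet h.cb h.cd with hc | hc
  · exact ha
  · exact ha
  · rw [ha, hc] at hpos
    exact absurd hpos (hneg _ _ _ hq.pos_abc)
  · rw [ha, hc] at hpos
    exact absurd hpos (hirr _ _)
  · rw [ha, hc] at hpos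
    exact absurd hpos (hirr _ _)
  · exact hc
  · rw [ha, hc] at hpos
    exact absurd hpos (hneg _ _ _ hq.pos_abc)
  · exact hc

/-! ### The derivative of the shear. -/

theorem HasDerivAt.log_mul_div {f g h k : ℝ → ℝ} {f' g' h' k' t : ℝ} (hf : HasDerivAt f f' t)
    (hg : HasDerivAt g g' t) (hh : HasDerivAt h h' t) (hk : HasDerivAt k k' t) (hf0 : f t ≠ 0)
    (hg0 : g t ≠ 0) (hh0 : h t ≠ 0) (hk0 : k t ≠ 0) :
    HasDerivAt (fun t => Real.log (f t * g t / (h t * k t)))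
      (f' / f t + g' / g t - h' / h t - k' / k t) t := by
  have := ((hf.mul hg).div (hh.mul hk) (mul_ne_zero hh0 hk0)).log
    (div_ne_zero (mul_ne_zero hf0 hg0) (mul_ne_zero hh0 hk0))
  refine this.congr_deriv ?_
  simp only [Pi.mul_apply, Pi.div_apply]
  field_simp
  ring

/-- If a point is `∞`, the difference is constant in `t`, and the factor `y * w` vanishes. -/
theorem IsPathTangentTo.hasDerivAt_diff {h : ℝ → ℝ → ℝ} {V : ℝ → ℝ} (hh : IsPathTangentTo h V)
    {x y z w : ℤ} (h1 : IsCoprime x y) (h2 : IsCoprime z w) :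
    HasDerivAt (fun t => diff (OnePoint.map (fun q : ℚ => h t q) (pt x y))
        (OnePoint.map (fun q : ℚ => h t q) (pt z w)))
      ((V (x / y) - V (z / w)) * (y * w) / (scale x y * scale z w)) 0 ∧
    diff (OnePoint.map (fun q : ℚ => h 0 q) (pt x y)) (OnePoint.map (fun q : ℚ => h 0 q) (pt z w)) =
      (x * w - z * y : ℝ) / (scale x y * scale z w) := by
  have s1 := scale_ne_zero h1
  have s2 := scale_ne_zero h2
  rw [← Int.cast_ne_zero (α := ℝ)] at s1 s2
  unfold scale pt at *
  split_ifs at * with hy hw hw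
  · simpa [hy, hw, diff] using hasDerivAt_const (0 : ℝ) (0 : ℝ)
  · refine ⟨?_, ?_⟩
    · simpa [hy, diff] using hasDerivAt_const (0 : ℝ) (1 : ℝ)
    · rw [hy]
      simp [diff]
      field_simp
  · refine ⟨?_, ?_⟩
    · simpa [hw, diff] using hasDerivAt_const (0 : ℝ) (-1 : ℝ)
    · rw [hw]
      simp [diff]
      field_simp
  · refine ⟨?_, ?_⟩
    · rw [mul_div_assoc, div_self (mul_ne_zero s1 s2), mul_one]
      have := (hh.deriv (x / y)).sub (hh.deriv (z / w))
      change HasDerivAt (fun t => h t ((x / y : ℚ) : ℝ) - h t ((z / w : ℚ) : ℝ)) _ 0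
      push_cast
      exact this
    · change h 0 ((x / y : ℚ) : ℝ) - h 0 ((z / w : ℚ) : ℝ) = _
      rw [hh.zero, hh.zero]
      push_cast
      field_simp

/-- At `t = 0` all four determinants are `1`; collecting the terms of the logarithmic derivative at
each vertex gives the squared second coordinate times `V`. -/
theorem IsPathTangentTo.hasDerivAt_shear {h : ℝ → ℝ → ℝ} {V : ℝ → ℝ} (hh : IsPathTangentTo h V)
    {x y z w : ℤ} (hd : z * y - w * x = 1) :
    HasDerivAt (fun t => shear (h t) (pt (x - z) (y - w)) (pt x y) (pt (x + z) (y + w)) (pt z w))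
      (defect (fun x y : ℤ => lift (fun q => V q) x y) x y z w) 0 := by
  have cb : IsCoprime x y := ⟨-w, z, by linarith⟩
  have cd : IsCoprime z w := ⟨y, -x, by linarith⟩
  have ca : IsCoprime (x - z) (y - w) := ⟨-w, z, by linarith⟩
  have cc : IsCoprime (x + z) (y + w) := ⟨-w, z, by linarith⟩
  have hdR : (z * y - w * x : ℝ) = 1 := by exact_mod_cast hd
  obtain ⟨d1, v1⟩ := hh.hasDerivAt_diff cc cb
  obtain ⟨d2, v2⟩ := hh.hasDerivAt_diff cd ca
  obtain ⟨d3, v3⟩ := hh.hasDerivAt_diff cb ca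
  obtain ⟨d4, v4⟩ := hh.hasDerivAt_diff cd cc
  have sa := scale_ne_zero ca
  have sb := scale_ne_zero cb
  have sc := scale_ne_zero cc
  have sd := scale_ne_zero cd
  rw [← Int.cast_ne_zero (α := ℝ)] at sa sb sc sd
  push_cast at v1 v2 v3 v4
  rw [show ((x + z) * y - x * (y + w) : ℝ) = 1 by linarith] at v1
  rw [show (z * (y - w) - (x - z) * w : ℝ) = 1 by linarith] at v2
  rw [show (x * (y - w) - (x - z) * y : ℝ) = 1 by linarith] at v3
  rw [show (z * (y + w) - (x + z) * w : ℝ) = 1 by linarith] at v4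
  have := HasDerivAt.log_mul_div d1 d2 d3 d4 (by rw [v1]; positivity) (by rw [v2]; positivity)
    (by rw [v3]; positivity) (by rw [v4]; positivity)
  rw [v1, v2, v3, v4] at this
  refine this.congr_deriv ?_
  simp only [defect, lift]
  push_cast
  generalize V ((x + z) / (y + w)) = vc
  generalize V ((x - z) / (y - w)) = va
  generalize V (x / y) = vb
  generalize V (z / w) = vd
  field_simp
  ring

/-! ### Edge functions and their potentials. -/

/-- The value of the edge function `s` on the edge with endpoints `(x, y)` and `(z, w)` in
homogeneous coordinates. -/
def edgeVal (s : Edge → ℝ) (x y z w : ℤ) : ℝ :=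
  open Classical in
  if h : fareyGraph.Adj (pt x y) (pt z w) then s ⟨s(pt x y, pt z w), h⟩ else 0

theorem edgeVal_eq (s : Edge → ℝ) {x y z w : ℤ} (e : Edge)
    (h : (e : Sym2 (OnePoint ℚ)) = s(pt x y, pt z w)) : s e = edgeVal s x y z w := by
  obtain ⟨e, he⟩ := e
  obtain rfl : e = s(pt x y, pt z w) := h
  rw [edgeVal, dif_pos (fareyGraph.mem_edgeSet.1 he)]

theorem edgeVal_neg_left (s : Edge → ℝ) (x y z w : ℤ) :
    edgeVal s (-x) (-y) z w = edgeVal s x y z w := by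
  unfold edgeVal
  rw [pt_neg]

theorem edgeVal_neg_right (s : Edge → ℝ) (x y z w : ℤ) :
    edgeVal s x y (-z) (-w) = edgeVal s x y z w := by
  unfold edgeVal
  rw [pt_neg]

theorem edgeVal_swap (s : Edge → ℝ) {x y z w : ℤ} (h : |x * w - y * z| = 1) :
    edgeVal s z w x y = edgeVal s x y z w := by
  rw [← edgeVal_eq s ⟨s(pt x y, pt z w), adj_of_abs_det h⟩ Sym2.eq_swap,
    ← edgeVal_eq s ⟨s(pt x y, pt z w), adj_of_abs_det h⟩ rfl]

theorem Edge.exists_eq (e : Edge) : ∃ x y z w : ℤ, |x * w - y * z| = 1 ∧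
    (e : Sym2 (OnePoint ℚ)) = s(pt x y, pt z w) := by
  obtain ⟨e, he⟩ := e
  induction e using Sym2.ind with
  | _ p q =>
    obtain ⟨x, y, hxy, rfl⟩ := exists_eq_pt p
    obtain ⟨z, w, hzw, rfl⟩ := exists_eq_pt q
    exact ⟨x, y, z, w, (adj_pt hxy hzw).1 (fareyGraph.mem_edgeSet.1 he), rfl⟩

/-- The edge function `s` measures how far `G` is from a quadratic form. -/
structure IsPotential (G : ℤ → ℤ → ℝ) (s : Edge → ℝ) : Prop where
  even : ∀ x y, G (-x) (-y) = G x y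
  edgeVal_eq : ∀ x y z w : ℤ, |x * w - y * z| = 1 → edgeVal s x y z w = defect G x y z w

theorem defect_neg_right {G : ℤ → ℤ → ℝ} (hG : ∀ x y, G (-x) (-y) = G x y) (x y z w : ℤ) :
    defect G x y (-z) (-w) = defect G x y z w := by
  simp only [defect, hG, sub_neg_eq_add, ← sub_eq_add_neg]
  ring

theorem defect_swap {G : ℤ → ℤ → ℝ} (hG : ∀ x y, G (-x) (-y) = G x y) (x y z w : ℤ) :
    defect G z w x y = defect G x y z w := by
  have := hG (x - z) (y - w)
  rw [neg_sub, neg_sub] at this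
  simp only [defect, this, add_comm z x, add_comm w y]
  ring

theorem defect_neg_left {G : ℤ → ℤ → ℝ} (hG : ∀ x y, G (-x) (-y) = G x y) (x y z w : ℤ) :
    defect G (-x) (-y) z w = defect G x y z w := by
  rw [defect_swap hG, defect_neg_right hG, defect_swap hG]

theorem lift_even (V : ℚ → ℝ) (x y : ℤ) : lift V ((-x : ℤ) : ℚ) ((-y : ℤ) : ℚ) = lift V x y := by
  push_cast
  exact lift_neg V x y

/-- The path `x + t * V x` pins down the value on each edge, and every other path gives the same
derivative. -/
theorem isInfinitesimalShear_iff {V : ℝ → ℝ} {s : Edge → ℝ} :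
    IsInfinitesimalShear V s ↔ IsPotential (fun x y : ℤ => lift (fun q => V q) x y) s := by
  constructor
  · intro h
    have hev := lift_even fun q => V q
    refine ⟨hev, fun x y z w hdet => ?_⟩
    wlog hd : z * y - w * x = 1 generalizing z w
    · have := this (-z) (-w)
        (by rw [← abs_neg, ← hdet]; ring_nf) (by
          rcases (abs_eq zero_le_one).1 hdet with h | h
          · linarith
          · exact absurd (by linarith) hd)
      rwa [edgeVal_neg_right, defect_neg_right (G := fun x y : ℤ => lift (fun q => V q) x y) hev]
        at this
    have hpath : IsPathTangentTo (fun t x => x + t * V x) V := by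
      refine ⟨fun x => by simp, fun x => ?_⟩
      simpa using ((hasDerivAt_id (0 : ℝ)).mul_const (V x)).const_add x
    have hq := isQuad_pt hd
    rw [← Farey.edgeVal_eq s ⟨s(pt x y, pt z w), hq.diag⟩ rfl]
    exact (h _ hpath _ _ _ _ hq).unique (hpath.hasDerivAt_shear hd)
  · intro h p hp a b c d hq
    obtain ⟨x, y, z, w, hd, rfl, rfl, rfl, rfl⟩ := hq.exists_pt
    rw [Farey.edgeVal_eq s ⟨s(pt x y, pt z w), hq.diag⟩ rfl, h.edgeVal_eq]
    · exact hp.hasDerivAt_shear hd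
    · rw [← abs_neg, show -(x * w - y * z) = 1 by linarith, abs_one]

/-- An edge determines its two vectors only up to sign and order, and the defect of an even function
ignores both. -/
theorem exists_isPotential {G : ℤ → ℤ → ℝ} (hG : ∀ x y, G (-x) (-y) = G x y) :
    ∃ s, IsPotential G s := by
  have : ∀ e : Edge, ∃ r : ℝ, ∀ x y z w : ℤ, |x * w - y * z| = 1 →
      (e : Sym2 (OnePoint ℚ)) = s(pt x y, pt z w) → r = defect G x y z w := by
    intro e
    obtain ⟨x, y, z, w, hd, he⟩ := e.exists_eq
    refine ⟨defect G x y z w, fun x' y' z' w' hd' he' => ?_⟩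
    rw [he, Sym2.eq_iff] at he'
    rcases he' with ⟨h1, h2⟩ | ⟨h1, h2⟩
    · rcases pt_eq_pt (isCoprime_left hd) (isCoprime_left hd') h1 with ⟨rfl, rfl⟩ | ⟨rfl, rfl⟩ <;>
      rcases pt_eq_pt (isCoprime_right hd) (isCoprime_right hd') h2 with ⟨rfl, rfl⟩ | ⟨rfl, rfl⟩ <;>
      simp only [defect_neg_left hG, defect_neg_right hG]
    · rw [defect_swap hG]
      rcases pt_eq_pt (isCoprime_left hd) (isCoprime_right hd') h1 with ⟨rfl, rfl⟩ | ⟨rfl, rfl⟩ <;>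
      rcases pt_eq_pt (isCoprime_right hd) (isCoprime_left hd') h2 with ⟨rfl, rfl⟩ | ⟨rfl, rfl⟩ <;>
      simp only [defect_neg_left hG, defect_neg_right hG, defect_swap hG]
  choose s hs using this
  refine ⟨s, hG, fun x y z w hd => ?_⟩
  rw [← edgeVal_eq s ⟨s(pt x y, pt z w), adj_of_abs_det hd⟩ rfl]
  exact hs _ x y z w hd rfl

theorem IsPotential.unique {G : ℤ → ℤ → ℝ} {s s' : Edge → ℝ} (h : IsPotential G s)
    (h' : IsPotential G s') : s = s' := by
  funext e
  obtain ⟨x, y, z, w, hd, he⟩ := e.exists_eq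
  rw [Farey.edgeVal_eq s e he, Farey.edgeVal_eq s' e he, h.edgeVal_eq _ _ _ _ hd, h'.edgeVal_eq _ _ _ _ hd]

/-! ### Fans and Cesàro sums. -/

theorem abs_det_pencil {a b c d : ℤ} (h : |a * d - b * c| = 1) (n : ℤ) :
    |c * (b + n * d) - d * (a + n * c)| = 1 := by
  rw [← h, ← abs_neg]; ring_nf

/-- The edges with endpoint `(c, d)`, enumerated by the points `(a, b) + n • (c, d)`. -/
def pencil {a b c d : ℤ} (h : |a * d - b * c| = 1) (n : ℤ) : Edge :=
  ⟨s(pt c d, pt (a + n * c) (b + n * d)), adj_of_abs_det (abs_det_pencil h n)⟩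

theorem exists_eq_pt_of_adj {a b c d : ℤ} (h : |a * d - b * c| = 1) {q : OnePoint ℚ}
    (hq : fareyGraph.Adj (pt c d) q) : ∃ n : ℤ, q = pt (a + n * c) (b + n * d) := by
  have hcd := isCoprime_right h
  obtain ⟨x, y, hdet, rfl⟩ : ∃ x y : ℤ, x * d - y * c = a * d - b * c ∧ q = pt x y := by
    obtain ⟨x, y, hxy, rfl⟩ := exists_eq_pt q
    have h2 := (adj_pt hcd hxy).1 hq
    rcases (abs_eq zero_le_one).1 h with h | h <;> rcases (abs_eq zero_le_one).1 h2 with h2 | h2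
    · exact ⟨-x, -y, by linarith, (pt_neg x y).symm⟩
    · exact ⟨x, y, by linarith, rfl⟩
    · exact ⟨x, y, by linarith, rfl⟩
    · exact ⟨-x, -y, by linarith, (pt_neg x y).symm⟩
  obtain ⟨r, t, hrt⟩ := hcd
  refine ⟨r * (x - a) + t * (y - b), ?_⟩
  congr 1
  · linear_combination (a - x) * hrt + t * hdet
  · linear_combination (b - y) * hrt - r * hdet

theorem pencil_injective {a b c d : ℤ} (h : |a * d - b * c| = 1) :
    Function.Injective (pencil h) := by
  intro m n hmn
  have h1 : pt (a + m * c) (b + m * d) = pt (a + n * c) (b + n * d) :=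
    Sym2.congr_right.1 (congrArg Subtype.val hmn)
  have hcop := fun k => isCoprime_right (abs_det_pencil h k)
  have h2 : (a * d - b * c) * (n - m) = 0 := by
    rcases pt_eq_pt (hcop m) (hcop n) h1 with ⟨e1, e2⟩ | ⟨e1, e2⟩
    · linear_combination (b + n * d) * e1 - (a + n * c) * e2
    · linear_combination (b + n * d) * e1 - (a + n * c) * e2
  rcases mul_eq_zero.1 h2 with h2 | h2
  · rw [h2] at h; simp at h
  · lia

theorem isFan_pencil {a b c d : ℤ} (h : |a * d - b * c| = 1) : IsFan (pt c d) (pencil h) := by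
  refine ⟨pencil_injective h, ?_, fun n => ⟨_, _, rfl, rfl, adj_of_abs_det ?_⟩⟩
  · ext E
    constructor
    · rintro ⟨n, rfl⟩
      exact Sym2.mem_mk_left _ _
    · intro hE
      obtain ⟨E, hE'⟩ := E
      obtain ⟨q, rfl⟩ : ∃ q, E = s(pt c d, q) := hE
      obtain ⟨n, rfl⟩ := exists_eq_pt_of_adj h (fareyGraph.mem_edgeSet.1 hE')
      exact ⟨n, rfl⟩
  · rw [show (a + n * c) * (b + (n + 1) * d) - (b + n * d) * (a + (n + 1) * c) = a * d - b * c by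
      ring, h]

/-- An injective sequence with unit steps cannot turn back. -/
theorem exists_eq_add_mul {k : ℤ → ℤ} (hk : Function.Injective k)
    (h : ∀ n, |k (n + 1) - k n| = 1) :
    ∃ ε : ℤ, |ε| = 1 ∧ ∀ n, k n = k 0 + n * ε := by
  have hstep : ∀ n, k (n + 1 + 1) - k (n + 1) = k (n + 1) - k n := by
    intro n
    have hne : k (n + 1 + 1) ≠ k n := fun e => by have := hk e; lia
    have h1 := h n
    have h2 := h (n + 1)
    rw [abs_eq zero_le_one] at h1 h2
    lia
  have hconst : ∀ n, k (n + 1) - k n = k 1 - k 0 := by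
    intro n
    induction n using Int.induction_on with
    | zero => simp
    | succ i ih => rw [hstep, ih]
    | pred i ih =>
      have := hstep (-i - 1)
      rw [sub_add_cancel] at this ⊢
      lia
  refine ⟨k 1 - k 0, by simpa using h 0, fun n => ?_⟩
  induction n using Int.induction_on with
  | zero => simp
  | succ i ih => linarith [hconst i]
  | pred i ih =>
    have := hconst (-i - 1)
    rw [sub_add_cancel] at this
    linarith

theorem IsFan.exists_eq_pencil {p : OnePoint ℚ} {e : ℤ → Edge} (he : IsFan p e) :
    ∃ (a b c d : ℤ) (h : |a * d - b * c| = 1), e = pencil h := by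
  obtain ⟨c, d, hcd, rfl⟩ := exists_eq_pt p
  have hmem : ∀ n, ∃ q, (e n : Sym2 (OnePoint ℚ)) = s(pt c d, q) ∧ fareyGraph.Adj (pt c d) q := by
    intro n
    have h1 : e n ∈ Set.range e := ⟨n, rfl⟩
    rw [he.range_eq] at h1
    obtain ⟨q, hq⟩ : ∃ q, (e n : Sym2 (OnePoint ℚ)) = s(pt c d, q) := h1
    refine ⟨q, hq, ?_⟩
    rw [← SimpleGraph.mem_edgeSet, ← hq]
    exact (e n).2
  obtain ⟨q, -, hq⟩ := hmem 0
  obtain ⟨a, b, hab, rfl⟩ := exists_eq_pt q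
  have hdet : |a * d - b * c| = 1 := (adj_pt hab hcd).1 hq.symm
  have hex : ∀ n, ∃ k, e n = pencil hdet k := by
    intro n
    obtain ⟨q, hq, hadj⟩ := hmem n
    obtain ⟨k, rfl⟩ := exists_eq_pt_of_adj hdet hadj
    exact ⟨k, Subtype.ext hq⟩
  choose k hk using hex
  have hcop := fun j => isCoprime_right (abs_det_pencil hdet j)
  obtain ⟨ε, hε, hkε⟩ := exists_eq_add_mul (k := k)
    (fun m n hmn => he.injective (by rw [hk, hk, hmn])) (fun n => by
      obtain ⟨q, r, h1, h2, h3⟩ := he.adjacent n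
      rw [hk] at h1 h2
      rw [← Sym2.congr_right.1 h1, ← Sym2.congr_right.1 h2, adj_pt (hcop _) (hcop _)] at h3
      rwa [show (a + k n * c) * (b + k (n + 1) * d) - (b + k n * d) * (a + k (n + 1) * c) =
        (a * d - b * c) * (k (n + 1) - k n) by ring, abs_mul, hdet, one_mul] at h3)
  -- The translation is absorbed in the base vector and the direction in the sign of the tip.
  have hdet' : |(a + k 0 * c) * (ε * d) - (b + k 0 * d) * (ε * c)| = 1 := by
    rw [show (a + k 0 * c) * (ε * d) - (b + k 0 * d) * (ε * c) = ε * (a * d - b * c) by ring,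
      abs_mul, hε, hdet, one_mul]
  refine ⟨_, _, _, _, hdet', funext fun n => ?_⟩
  rw [hk]
  apply Subtype.ext
  have hpt : pt (ε * c) (ε * d) = pt c d := by
    rcases (abs_eq zero_le_one).1 hε with rfl | rfl
    · simp
    · simpa using pt_neg c d
  have h1 : a + k 0 * c + n * (ε * c) = a + k n * c := by rw [hkε n]; ring
  have h2 : b + k 0 * d + n * (ε * d) = b + k n * d := by rw [hkε n]; ring
  simp only [pencil, hpt, h1, h2]

/-- Multiplied by `k + 1`, the weighted sum is the sum of the symmetric partial sums. Each of these
telescopes to first differences (`hU`), and their sum telescopes again (`hT`). -/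
theorem cesaro_sum_eq (f : ℤ → ℝ) (w : ℝ) (m : ℤ) (k : ℕ) :
    ((k : ℝ) + 1) * ((f (m + 1) + f (m - 1) - 2 * f m - w) + ∑ j ∈ Finset.Icc 1 k,
      (((k : ℝ) + 1 - (j : ℝ)) / ((k : ℝ) + 1)) *
        ((f (m + j + 1) + f (m + j - 1) - 2 * f (m + j) - w) +
          (f (m - j + 1) + f (m - j - 1) - 2 * f (m - j) - w))) =
      f (m + (k + 1)) + f (m - (k + 1)) - 2 * f m - ((k : ℝ) + 1) ^ 2 * w := by
  set X : ℕ → ℝ := fun j => (f (m + j + 1) + f (m + j - 1) - 2 * f (m + j) - w) +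
    (f (m - j + 1) + f (m - j - 1) - 2 * f (m - j) - w) with hX
  set g := f (m + 1) + f (m - 1) - 2 * f m - w with hg
  have hU : ∀ k : ℕ, g + ∑ j ∈ Finset.Icc 1 k, X j =
      f (m + k + 1) - f (m + k) + f (m - k - 1) - f (m - k) - (2 * k + 1) * w := by
    intro k
    induction k with
    | zero => simp [hg]; ring
    | succ k ih =>
      rw [Finset.sum_Icc_succ_top (by lia), ← add_assoc, ih, hX]
      push_cast
      rw [show m + ((k : ℤ) + 1) - 1 = m + k by ring, show m - ((k : ℤ) + 1) + 1 = m - k by ring,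
        show m + (k : ℤ) + 1 = m + (k + 1) by ring, show m - (k : ℤ) - 1 = m - (k + 1) by ring]
      ring
  have hT : ∀ k : ℕ, ((k : ℝ) + 1) * g + ∑ j ∈ Finset.Icc 1 k, ((k : ℝ) + 1 - j) * X j =
      f (m + (k + 1)) + f (m - (k + 1)) - 2 * f m - ((k : ℝ) + 1) ^ 2 * w := by
    intro k
    induction k with
    | zero => simp [hg]
    | succ k ih =>
      have e : ∑ j ∈ Finset.Icc 1 (k + 1), (((k + 1 : ℕ) : ℝ) + 1 - j) * X j =
          (∑ j ∈ Finset.Icc 1 k, ((k : ℝ) + 1 - j) * X j) + ∑ j ∈ Finset.Icc 1 (k + 1), X j := by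
        rw [Finset.sum_Icc_succ_top (by lia), Finset.sum_Icc_succ_top (by lia), ← add_assoc,
          ← Finset.sum_add_distrib]
        congr 1
        · refine Finset.sum_congr rfl fun j _ => ?_
          push_cast; ring
        · push_cast; ring
      rw [e]
      have := hU (k + 1)
      push_cast at this ⊢
      rw [show m + ((k : ℤ) + 1) + 1 = m + (k + 1 + 1) by ring,
        show m - ((k : ℤ) + 1) - 1 = m - (k + 1 + 1) by ring] at this
      linarith
  rw [← hT k, mul_add, Finset.mul_sum]
  congr 1
  refine Finset.sum_congr rfl fun j _ => ?_
  have : (k : ℝ) + 1 ≠ 0 := by positivity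
  simp only [hX]
  field_simp

theorem IsPotential.apply_pencil {G : ℤ → ℤ → ℝ} {s : Edge → ℝ} (hG : IsPotential G s)
    {a b c d : ℤ} (h : |a * d - b * c| = 1) (n : ℤ) :
    s (pencil h n) = G (a + (n + 1) * c) (b + (n + 1) * d) + G (a + (n - 1) * c) (b + (n - 1) * d) -
      2 * G (a + n * c) (b + n * d) - 2 * G c d := by
  rw [Farey.edgeVal_eq s (pencil h n) rfl, hG.edgeVal_eq _ _ _ _ (abs_det_pencil h n),
    defect_swap hG.even, defect]
  ring_nf

theorem IsPotential.cesaro_pencil {G : ℤ → ℤ → ℝ} {s : Edge → ℝ} (hG : IsPotential G s)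
    {a b c d : ℤ} (h : |a * d - b * c| = 1) (m : ℤ) (k : ℕ) :
    ((k : ℝ) + 1) * (s (pencil h m) + ∑ j ∈ Finset.Icc 1 k,
      (((k : ℝ) + 1 - (j : ℝ)) / ((k : ℝ) + 1)) *
        (s (pencil h (m + (j : ℤ))) + s (pencil h (m - (j : ℤ))))) =
      G (a + (m + (k + 1)) * c) (b + (m + (k + 1)) * d) +
      G (a + (m - (k + 1)) * c) (b + (m - (k + 1)) * d) -
      2 * G (a + m * c) (b + m * d) - 2 * ((k : ℝ) + 1) ^ 2 * G c d := by
  have := cesaro_sum_eq (fun n => G (a + n * c) (b + n * d)) (2 * G c d) m k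
  simp only [hG.apply_pencil]
  rw [this]
  ring

theorem IsPotential.cesaroBound_iff {G : ℤ → ℤ → ℝ} {s : Edge → ℝ} (hG : IsPotential G s)
    {C : ℝ} : CesaroBound C s ↔ FanBound C G := by
  constructor
  · intro h a b c d hdet N hN
    obtain ⟨k, rfl⟩ : ∃ k : ℕ, N = k + 1 := ⟨(N - 1).toNat, by lia⟩
    have h1 := h _ _ (isFan_pencil hdet) 0 k
    have h2 := hG.cesaro_pencil hdet 0 k
    simp only [zero_add, zero_mul, add_zero, zero_sub] at h1 h2
    have hk : (0 : ℝ) < k + 1 := by positivity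
    rw [show a - ((k : ℤ) + 1) * c = a + -(k + 1) * c by ring,
      show b - ((k : ℤ) + 1) * d = b + -(k + 1) * d by ring]
    push_cast
    rw [← h2, abs_mul, abs_of_pos hk, mul_comm C]
    gcongr
  · intro h p e he m k
    obtain ⟨a, b, c, d, hdet, rfl⟩ := he.exists_eq_pencil
    have hk : (0 : ℝ) < k + 1 := by positivity
    have h1 := hG.cesaro_pencil hdet m k
    have h2 := h (a + m * c) (b + m * d) c d (by rw [← hdet]; ring_nf) (k + 1) (by lia)
    rw [show a + m * c + ((k : ℤ) + 1) * c = a + (m + (k + 1)) * c by ring,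
      show b + m * d + ((k : ℤ) + 1) * d = b + (m + (k + 1)) * d by ring,
      show a + m * c - ((k : ℤ) + 1) * c = a + (m - (k + 1)) * c by ring,
      show b + m * d - ((k : ℤ) + 1) * d = b + (m - (k + 1)) * d by ring] at h2
    push_cast at h2
    rw [← h1, abs_mul, abs_of_pos hk, mul_comm C] at h2
    exact le_of_mul_le_mul_left h2 hk

/-- The vectors `u` and `N • v` have determinant `±N`. -/
theorem CoarseZygmund.fanBound {K : ℝ} {V : ℚ → ℝ} (hK : 0 ≤ K) (h : CoarseZygmund K 0 V) :
    FanBound (5 * K) fun x y => lift V x y := by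
  intro a b c d hdet N hN
  have := h.defect_le hK le_rfl a b (N * c) (N * d)
  rw [defect, lift_mul] at this
  have hdetR : |(a * d - b * c : ℝ)| = 1 := by exact_mod_cast hdet
  have hN0 : (0 : ℝ) ≤ N := by exact_mod_cast (by lia : 0 ≤ N)
  have e : |((a : ℚ) : ℝ) * ((N * d : ℚ) : ℝ) - ((N * c : ℚ) : ℝ) * ((b : ℚ) : ℝ)| = N := by
    push_cast
    rw [show (a * (N * d) - N * c * b : ℝ) = N * (a * d - b * c) by ring, abs_mul, hdetR, mul_one,
      abs_of_nonneg hN0]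
  rw [e, zero_mul, add_zero] at this
  push_cast at this ⊢
  rw [mul_assoc 5, mul_assoc 2]
  exact this

/-! ### Constructing a potential on the Farey tree. -/

/-- The solution in the first quadrant of the equation `defect G = S`, with `G = 0` on the
coordinate axes and `G 1 1 = c`, computed by descending the Farey tree. -/
def topograph (S : ℤ → ℤ → ℤ → ℤ → ℝ) (c : ℝ) (x y : ℕ) : ℝ :=
  if x = 0 ∨ y = 0 then 0 else
    c * (x * y) +
      if y < x then topograph (fun x y z w => S (x + y) y (z + w) w) (S 1 0 1 1) (x - y) y
      else if x < y then topograph (fun x y z w => S x (x + y) z (z + w)) (S 1 1 0 1) x (y - x)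
      else 0
termination_by x + y

theorem topograph_zero_left (S : ℤ → ℤ → ℤ → ℤ → ℝ) (c : ℝ) (y : ℕ) : topograph S c 0 y = 0 := by
  rw [topograph]; simp

theorem topograph_zero_right (S : ℤ → ℤ → ℤ → ℤ → ℝ) (c : ℝ) (x : ℕ) :
    topograph S c x 0 = 0 := by
  rw [topograph]; simp

theorem topograph_one_one (S : ℤ → ℤ → ℤ → ℤ → ℝ) (c : ℝ) : topograph S c 1 1 = c := by
  rw [topograph]; simp

/-- The form `c * x * y` has the prescribed values at `(1, 0)`, `(0, 1)`, `(1, 1)`. The remainder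
vanishes at the basis `(1, 0)`, `(1, 1)` of the half cone and at `(0, 1)`, so its value at `(2, 1)`
is the defect `S 1 0 1 1`. -/
theorem topograph_add_left (S : ℤ → ℤ → ℤ → ℤ → ℝ) (c : ℝ) (x y : ℕ) :
    topograph S c (x + y) y = c * ((x + y) * y) +
      topograph (fun x y z w => S (x + y) y (z + w) w) (S 1 0 1 1) x y := by
  rcases Nat.eq_zero_or_pos y with rfl | hy
  · simp [topograph_zero_right]
  rcases Nat.eq_zero_or_pos x with rfl | hx
  · rw [topograph_zero_left, topograph]
    simp [hy.ne']
  rw [topograph, if_neg (by lia), if_pos (by lia), Nat.add_sub_cancel]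
  push_cast
  rfl

theorem topograph_add_right (S : ℤ → ℤ → ℤ → ℤ → ℝ) (c : ℝ) (x y : ℕ) :
    topograph S c x (x + y) = c * (x * (x + y)) +
      topograph (fun x y z w => S x (x + y) z (z + w)) (S 1 1 0 1) x y := by
  rcases Nat.eq_zero_or_pos x with rfl | hx
  · simp [topograph_zero_left]
  rcases Nat.eq_zero_or_pos y with rfl | hy
  · rw [topograph_zero_right, topograph]
    simp [hx.ne']
  rw [topograph, if_neg (by lia), if_neg (by lia), if_pos (by lia), Nat.add_sub_cancel_left]
  push_cast
  rfl

/-- The step of the Stern–Brocot descent: in a nonnegative matrix of determinant `1` other than the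
identity, one row dominates the other. -/
theorem eq_or_le_of_det {x y z w : ℕ} (h : x * w = y * z + 1) :
    (x = 1 ∧ y = 0 ∧ z = 0 ∧ w = 1) ∨ (x ≤ z ∧ y ≤ w) ∨ (z ≤ x ∧ w ≤ y) := by
  rcases le_or_gt x z with hxz | hxz
  · refine Or.inr (Or.inl ⟨hxz, ?_⟩)
    by_contra hyw
    push Not at hyw
    nlinarith
  rcases le_or_gt w y with hwy | hwy
  · exact Or.inr (Or.inr ⟨hxz.le, hwy⟩)
  · left
    have : z = 0 ∧ y = 0 := by
      have : (z + 1) * (y + 1) ≤ x * w := Nat.mul_le_mul hxz hwy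
      constructor <;> nlinarith
    obtain ⟨rfl, rfl⟩ := this
    have := mul_eq_one.1 (by simpa using h : x * w = 1)
    exact ⟨this.1, rfl, rfl, this.2⟩

theorem topograph_children (n : ℕ) : ∀ (S : ℤ → ℤ → ℤ → ℤ → ℝ) (c : ℝ) {x y z w : ℕ},
    x * w = y * z + 1 → x + y + z + w ≤ n →
    topograph S c (x + (x + z)) (y + (y + w)) + topograph S c z w - 2 * topograph S c x y -
        2 * topograph S c (x + z) (y + w) = S x y (x + z) (y + w) ∧
    topograph S c (x + z + z) (y + w + w) + topograph S c x y - 2 * topograph S c (x + z) (y + w) -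
        2 * topograph S c z w = S (x + z) (y + w) z w := by
  induction n with
  | zero =>
    intro S c x y z w h hn
    obtain rfl : x = 0 := by lia
    lia
  | succ n ih =>
    intro S c x y z w h hn
    -- Applied to the transpose: unless the basis is standard, both its vectors lie in the same half
    -- cone, where the recursion applies.
    have hcone := eq_or_le_of_det (h.trans (by rw [mul_comm y z]) : x * w = z * y + 1)
    rcases hcone with ⟨rfl, rfl, rfl, rfl⟩ | ⟨hxy, hzw⟩ | ⟨hyx, hwz⟩
    · have e1 := topograph_add_left S c 1 1
      have e2 := topograph_add_right S c 1 1
      rw [topograph_one_one] at e1 e2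
      norm_num [topograph_zero_left, topograph_zero_right, topograph_one_one] at e1 e2 ⊢
      rw [e1, e2]
      constructor <;> ring
    · obtain ⟨a, rfl⟩ := Nat.exists_eq_add_of_le hxy
      obtain ⟨b, rfl⟩ := Nat.exists_eq_add_of_le hzw
      have h' : x * b = a * z + 1 := by nlinarith
      have hpos : 0 < x + z := by
        by_contra h0
        obtain ⟨rfl, rfl⟩ : x = 0 ∧ z = 0 := by lia
        simp at h
      obtain ⟨h1, h2⟩ := ih (fun x y z w => S x (x + y) z (z + w)) (S 1 1 0 1) h' (by lia)
      rw [show x + a + (x + a + (z + b)) = x + (x + z) + (a + (a + b)) by ring,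
        show x + a + (z + b) + (z + b) = x + z + z + (a + b + b) by ring,
        show x + a + (z + b) = x + z + (a + b) by ring]
      simp only [topograph_add_right]
      push_cast at h1 h2 ⊢
      rw [show (x + a + (z + b) : ℤ) = x + z + (a + b) by ring, ← h1, ← h2]
      constructor <;> ring
    · obtain ⟨a, rfl⟩ := Nat.exists_eq_add_of_le' hyx
      obtain ⟨b, rfl⟩ := Nat.exists_eq_add_of_le' hwz
      have h' : a * w = y * b + 1 := by nlinarith
      have hpos : 0 < y + w := by
        by_contra h0
        obtain ⟨rfl, rfl⟩ : y = 0 ∧ w = 0 := by lia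
        simp at h
      obtain ⟨h1, h2⟩ := ih (fun x y z w => S (x + y) y (z + w) w) (S 1 0 1 1) h' (by lia)
      rw [show a + y + (a + y + (b + w)) = a + (a + b) + (y + (y + w)) by ring,
        show a + y + (b + w) + (b + w) = a + b + b + (y + w + w) by ring,
        show a + y + (b + w) = a + b + (y + w) by ring]
      simp only [topograph_add_left]
      push_cast at h1 h2 ⊢
      rw [show (a + y + (b + w) : ℤ) = a + b + (y + w) by ring, ← h1, ← h2]
      constructor <;> ring

theorem defect_eq_of_topograph {S : ℤ → ℤ → ℤ → ℤ → ℝ} {c : ℝ} {G : ℤ → ℤ → ℝ}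
    (hG : ∀ x y : ℤ, 0 ≤ x * y → G x y = topograph S c x.natAbs y.natAbs)
    (h1 : defect G 1 0 0 1 = S 1 0 0 1) {x y z w : ℕ} (h : x * w = y * z + 1) :
    defect G x y z w = S x y z w := by
  have hnat : ∀ x y : ℕ, G x y = topograph S c x y := fun x y => by
    simpa using hG x y (by positivity)
  have hneg : ∀ x y : ℕ, G (-x) (-y) = topograph S c x y := fun x y => by
    simpa using hG (-x) (-y) (by rw [neg_mul_neg]; positivity)
  rcases eq_or_le_of_det h with ⟨rfl, rfl, rfl, rfl⟩ | ⟨h1, h2⟩ | ⟨h1, h2⟩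
  · exact_mod_cast h1
  · obtain ⟨z, rfl⟩ := Nat.exists_eq_add_of_le h1
    obtain ⟨w, rfl⟩ := Nat.exists_eq_add_of_le h2
    have := (topograph_children _ S c (x := x) (y := y) (z := z) (w := w) (by nlinarith) le_rfl).1
    rw [← hnat (x + (x + z)), ← hneg z w, ← hnat x y, ← hnat (x + z)] at this
    push_cast at this ⊢
    rw [← this, defect, sub_add_cancel_left, sub_add_cancel_left]
  · obtain ⟨x, rfl⟩ := Nat.exists_eq_add_of_le' h1
    obtain ⟨y, rfl⟩ := Nat.exists_eq_add_of_le' h2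
    have := (topograph_children _ S c (x := x) (y := y) (z := z) (w := w) (by nlinarith) le_rfl).2
    rw [← hnat, ← hnat, ← hnat, ← hnat] at this
    push_cast at this ⊢
    rw [← this, defect, add_sub_cancel_right, add_sub_cancel_right]

/-- The three zero values use up the freedom of adding a quadratic form. The second quadrant is the
reflection of the first, and evenness gives the rest. -/
theorem exists_potential (s : Edge → ℝ) :
    ∃ G : ℤ → ℤ → ℝ, IsPotential G s ∧ G 1 0 = 0 ∧ G 0 1 = 0 ∧ G 1 1 = 0 := by
  set S : ℤ → ℤ → ℤ → ℤ → ℝ := edgeVal s with hS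
  set S' : ℤ → ℤ → ℤ → ℤ → ℝ := fun x y z w => S (-x) y (-z) w with hS'
  -- The edge joining the axes forces `G (-1) 1 = S 1 0 0 1`, because `G` vanishes at `(1, 0)`, `(0,
  -- 1)` and `(1, 1)`.
  set G : ℤ → ℤ → ℝ := fun x y => if 0 ≤ x * y then topograph S 0 x.natAbs y.natAbs
    else topograph S' (S 1 0 0 1) x.natAbs y.natAbs with hGdef
  have hGpos : ∀ x y : ℤ, 0 ≤ x * y → G x y = topograph S 0 x.natAbs y.natAbs := fun x y h =>
    if_pos h
  have hGneg : ∀ x y : ℤ, 0 ≤ x * y →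
      G (-x) y = topograph S' (S 1 0 0 1) x.natAbs y.natAbs := by
    intro x y h
    rcases h.eq_or_lt with h | h
    · rcases mul_eq_zero.1 h.symm with rfl | rfl <;>
      simp [hGdef, topograph_zero_left, topograph_zero_right]
    · have : ¬ 0 ≤ -x * y := by rw [neg_mul]; lia
      simp only [hGdef, if_neg this, Int.natAbs_neg]
  have even : ∀ x y, G (-x) (-y) = G x y := fun x y => by
    simp only [hGdef, neg_mul_neg, Int.natAbs_neg]
  have g10 : G 1 0 = 0 := by simp [hGdef, topograph_zero_right]
  have g01 : G 0 1 = 0 := by simp [hGdef, topograph_zero_left]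
  have g11 : G 1 1 = 0 := by simp [hGdef, topograph_one_one]
  have gm : G (-1) 1 = S 1 0 0 1 := by simpa [topograph_one_one] using hGneg 1 1 (by norm_num)
  have gm' : G 1 (-1) = S 1 0 0 1 := by simpa [gm] using (even (-1) 1)
  have g0m : G 0 (-1) = 0 := by simpa [g01] using even 0 1
  have gm0 : G (-1) 0 = 0 := by simpa [g10] using even 1 0
  have gmm : G (-1) (-1) = 0 := by simpa [g11] using even 1 1
  have first : ∀ x y z w : ℕ, |(x : ℤ) * w - y * z| = 1 →
      S x y z w = defect G x y z w := by
    intro x y z w h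
    rcases (abs_eq zero_le_one).1 h with h1 | h1
    · refine (defect_eq_of_topograph hGpos ?_ (by zify; linarith)).symm
      simp [defect, g11, g10, g01, gm']
    · rw [hS, ← edgeVal_swap s h, ← defect_swap even]
      refine (defect_eq_of_topograph hGpos ?_ (by zify; linarith)).symm
      simp [defect, g11, g10, g01, gm', hS]
  have h01 : defect (fun x y => G (-x) y) 1 0 0 1 = S' 1 0 0 1 := by
    have := edgeVal_neg_left s 1 0 0 1
    rw [neg_zero] at this
    simp [defect, g01, gm0, gm, gmm, hS', hS, this]
  have hdef : ∀ x y z w : ℤ, defect G (-x) y (-z) w = defect (fun x y => G (-x) y) x y z w := by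
    intro x y z w
    simp only [defect]
    rw [show -x + -z = -(x + z) by ring, show -x - -z = -(x - z) by ring]
  have second : ∀ x y z w : ℕ, |(x : ℤ) * w - y * z| = 1 →
      S (-x) y (-z) w = defect G (-x) y (-z) w := by
    intro x y z w h
    rcases (abs_eq zero_le_one).1 h with h1 | h1
    · rw [hdef]
      exact (defect_eq_of_topograph hGneg h01 (by zify; linarith)).symm
    · have h' : |(-(x : ℤ)) * w - y * (-z)| = 1 := by
        rw [← h, ← abs_neg]; ring_nf
      rw [hS, ← edgeVal_swap s h', ← defect_swap even, hdef]
      exact (defect_eq_of_topograph hGneg h01 (by zify; linarith)).symm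
  refine ⟨G, ⟨even, fun x y z w h => ?_⟩, g10, g01, g11⟩
  wlog hy : 0 ≤ y generalizing x y
  · have := this (-x) (-y) (by rw [← h, ← abs_neg]; ring_nf) (by lia)
    rwa [edgeVal_neg_left, defect_neg_left even] at this
  wlog hw : 0 ≤ w generalizing z w
  · have := this (-z) (-w) (by rw [← h, ← abs_neg]; ring_nf) (by lia)
    rwa [edgeVal_neg_right, defect_neg_right even] at this
  wlog hxz : z ≤ x generalizing x y z w
  · have hswap : |z * y - w * x| = 1 := by rw [abs_det_comm, h]
    have := this z w hw x y hswap hy (by lia)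
    rwa [edgeVal_swap s h, defect_swap even] at this
  lift y to ℕ using hy
  lift w to ℕ using hw
  have hI : ∀ x z : ℤ, 0 ≤ x → 0 ≤ z → |x * w - y * z| = 1 →
      edgeVal s x y z w = defect G x y z w := by
    intro x z hx hz h
    lift x to ℕ using hx
    lift z to ℕ using hz
    exact first _ _ _ _ h
  have hII : ∀ x z : ℤ, x ≤ 0 → z ≤ 0 → |x * w - y * z| = 1 →
      edgeVal s x y z w = defect G x y z w := by
    intro x z hx hz h
    obtain ⟨x, rfl⟩ := Int.exists_eq_neg_ofNat hx
    obtain ⟨z, rfl⟩ := Int.exists_eq_neg_ofNat hz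
    exact second _ _ _ _ (by rw [← h, ← abs_neg]; ring_nf)
  rcases le_or_gt 0 z with hz | hz
  · exact hI x z (hz.trans hxz) hz h
  rcases le_or_gt x 0 with hx | hx
  · exact hII x z hx hz.le h
  rcases Nat.eq_zero_or_pos y with rfl | hy0
  · have := hII (-x) z (by lia) hz.le (by rw [← h, ← abs_neg]; push_cast; ring_nf)
    have e1 := edgeVal_neg_left s x 0 z w
    have e2 := defect_neg_left even x 0 z w
    rw [neg_zero] at e1 e2
    push_cast at this ⊢
    rwa [e1, e2] at this
  rcases Nat.eq_zero_or_pos w with rfl | hw0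
  · have := hI x (-z) hx.le (by lia) (by rw [← h, ← abs_neg]; push_cast; ring_nf)
    have e1 := edgeVal_neg_right s x y z 0
    have e2 := defect_neg_right even x y z 0
    rw [neg_zero] at e1 e2
    push_cast at this ⊢
    rwa [e1, e2] at this
  -- No edge joins the interiors of two adjacent quadrants: the determinant would be at least `2`.
  · exfalso
    have h1 : 1 ≤ x * (w : ℤ) := by
      have : (1 : ℤ) ≤ w := by exact_mod_cast hw0
      nlinarith
    have h2 : 1 ≤ (y : ℤ) * -z := by
      have : (1 : ℤ) ≤ y := by exact_mod_cast hy0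
      nlinarith
    have h3 := le_abs_self (x * w - y * z)
    rw [h] at h3
    linarith

/-- Only primitive vectors occur in edges, so `G` need not be homogeneous; `G 1 0 = 0` matches the
lift at `∞`. -/
theorem exists_lift_potential (s : Edge → ℝ) : ∃ V : ℚ → ℝ,
    IsPotential (fun x y : ℤ => lift V x y) s ∧ V 0 = 0 ∧ V 1 = 0 := by
  obtain ⟨G, hG, h10, h01, h11⟩ := exists_potential s
  have hm : G (-1) 0 = 0 := by simpa [h10] using hG.even 1 0
  set V : ℚ → ℝ := fun q => G q.num q.den / (q.den : ℝ) ^ 2 with hV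
  have key : ∀ {x y : ℤ}, IsCoprime x y → lift V x y = G x y := by
    intro x y h
    rcases eq_or_ne y 0 with rfl | hy
    · rw [Int.cast_zero, lift_zero_right]
      rcases Int.isUnit_iff.1 (isCoprime_zero_right.1 h) with rfl | rfl
      · exact h10.symm
      · exact hm.symm
    · have e1 : num (pt x y) = (x / y : ℚ).num := by simp [pt, hy]; rfl
      have e2 : den (pt x y) = (x / y : ℚ).den := by simp [pt, hy]; rfl
      have hyR : (y : ℝ) ≠ 0 := by exact_mod_cast hy
      have hGxy : G (x / y : ℚ).num (x / y : ℚ).den = G x y ∧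
          (((x / y : ℚ).den : ℤ) : ℝ) ^ 2 = (y : ℝ) ^ 2 := by
        rw [← e1, ← e2]
        rcases num_den_pt h with ⟨h1, h2⟩ | ⟨h1, h2⟩ <;> rw [h1, h2]
        · exact ⟨rfl, rfl⟩
        · exact ⟨hG.even x y, by push_cast; ring⟩
      have h2 := hGxy.2
      rw [Int.cast_natCast] at h2
      simp only [lift, hV, hGxy.1, h2]
      push_cast
      field_simp
  refine ⟨V, ⟨lift_even V, fun x y z w h => ?_⟩, ?_, ?_⟩
  · have h1 := isCoprime_left h
    have h2 := isCoprime_right h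
    have h3 : IsCoprime (x + z) (y + w) :=
      isCoprime_left (z := z) (w := w) (by rw [← h]; ring_nf)
    have h4 : IsCoprime (x - z) (y - w) :=
      isCoprime_left (z := z) (w := w) (by rw [← h]; ring_nf)
    rw [hG.edgeVal_eq _ _ _ _ h]
    simp only [defect, key h1, key h2, key h3, key h4]
  · simpa [h01, lift_one_right] using key (x := 0) (y := 1) isCoprime_one_right
  · simpa [h11, lift_one_right] using key (x := 1) (y := 1) isCoprime_one_right

/-! ### Proof of the theorem. -/

theorem IsPotential.sub {V W : ℚ → ℝ} {s s' : Edge → ℝ}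
    (hV : IsPotential (fun x y : ℤ => lift V x y) s)
    (hW : IsPotential (fun x y : ℤ => lift W x y) s') :
    IsPotential (fun x y : ℤ => lift (fun q => V q - W q) x y) (fun e => s e - s' e) := by
  refine ⟨lift_even _, fun x y z w h => ?_⟩
  have e : edgeVal (fun e => s e - s' e) x y z w = edgeVal s x y z w - edgeVal s' x y z w := by
    unfold edgeVal
    split_ifs <;> simp
  rw [e, hV.edgeVal_eq _ _ _ _ h, hW.edgeVal_eq _ _ _ _ h]
  simp only [defect, lift]
  ring

theorem zygmundBounded_of_cesaroBound {C : ℝ} {s : Edge → ℝ} (hs : CesaroBound C s) {V : ℝ → ℝ}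
    (hc : Continuous V) (hV : IsInfinitesimalShear V s) : ZygmundBounded (140 * C) V :=
  zygmundBounded_of_rat hc
    ((isInfinitesimalShear_iff.1 hV).cesaroBound_iff.1 hs).zygmund

theorem IsNormalizedZygmund.exists_cesaroBound {V : ℝ → ℝ} (hV : IsNormalizedZygmund V)
    {s : Edge → ℝ} (hs : IsInfinitesimalShear V s) : ∃ C : ℝ, 0 < C ∧ CesaroBound C s := by
  obtain ⟨K, hK, hz⟩ := hV.zygmund
  exact ⟨5 * K, by positivity,
    (isInfinitesimalShear_iff.1 hs).cesaroBound_iff.2 (hz.coarseZygmund.fanBound hK.le)⟩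

theorem CesaroBound.exists_vectorField {C : ℝ} (hC : 0 < C) {s : Edge → ℝ} (hs : CesaroBound C s) :
    ∃ V : ℝ → ℝ, IsNormalizedZygmund V ∧ IsInfinitesimalShear V s := by
  obtain ⟨V, hV, h0, h1⟩ := exists_lift_potential s
  have hz := (hV.cesaroBound_iff.1 hs).zygmund
  obtain ⟨W, hW, hWV⟩ := hz.exists_extension (by positivity)
  obtain rfl : (fun q : ℚ => W q) = V := funext hWV
  have hb := zygmundBounded_of_rat hW hz
  have hW0 : W 0 = 0 := by simpa using h0
  exact ⟨W, ⟨hW, ⟨140 * C, by positivity, hb⟩, hW0, by simpa using h1, hb.vanish_infty hW hW0⟩,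
    isInfinitesimalShear_iff.2 hV⟩

/-- By linearity `V - W` has zero shears, so (10) holds with constant `0`, and the Zygmund bound
with it. -/
theorem IsNormalizedZygmund.eq_of_isInfinitesimalShear {V W : ℝ → ℝ} {s : Edge → ℝ}
    (hV : IsNormalizedZygmund V) (hVs : IsInfinitesimalShear V s)
    (hW : IsNormalizedZygmund W) (hWs : IsInfinitesimalShear W s) : V = W := by
  have hp : IsPotential _ (fun e => s e - s e) :=
    (isInfinitesimalShear_iff.1 hVs).sub (isInfinitesimalShear_iff.1 hWs)
  have hs : CesaroBound 0 (fun e : Edge => s e - s e) := by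
    intro p e _ m k
    simp
  have hc := hV.continuous.sub hW.continuous
  have hz := zygmundBounded_of_rat hc (hp.cesaroBound_iff.1 hs).zygmund
  rw [mul_zero] at hz
  exact sub_eq_zero.1 (hz.eq_zero hc (by simp [hV.map_zero, hW.map_zero])
    (by simp [hV.map_one, hW.map_one]))

end

end Farey

theorem theorem4p1 :
    -- a normalized Zygmund vector field has one and only one infinitesimal shear function
    (∀ V : ℝ → ℝ, Farey.IsNormalizedZygmund V →
      ∃! s : Farey.Edge → ℝ, Farey.IsInfinitesimalShear V s) ∧
    -- characterization of the functions on the edges that arise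
    (∀ s : Farey.Edge → ℝ,
      (∃ V : ℝ → ℝ, Farey.IsNormalizedZygmund V ∧ Farey.IsInfinitesimalShear V s) ↔
        ∃ C : ℝ, 0 < C ∧ Farey.CesaroBound C s) ∧
    -- the infinitesimal shear function determines the vector field
    (∀ s : Farey.Edge → ℝ, ∀ V W : ℝ → ℝ,
      Farey.IsNormalizedZygmund V → Farey.IsInfinitesimalShear V s →
      Farey.IsNormalizedZygmund W → Farey.IsInfinitesimalShear W s → V = W) ∧
    -- the Zygmund norm is controlled by the constant of the bound
    (∃ M : ℝ → ℝ, ∀ C : ℝ, 0 < C → 0 < M C ∧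
      ∀ s : Farey.Edge → ℝ, Farey.CesaroBound C s →
        ∀ V : ℝ → ℝ, Farey.IsNormalizedZygmund V → Farey.IsInfinitesimalShear V s →
          Farey.ZygmundBounded (M C) V) := by
  refine ⟨fun V _ => ?_, fun s => ⟨?_, ?_⟩, fun s V W hV hVs hW hWs =>
    hV.eq_of_isInfinitesimalShear hVs hW hWs, fun C => 140 * C, fun C hC => ⟨by positivity,
      fun s hs V hV hVs => Farey.zygmundBounded_of_cesaroBound hs hV.continuous hVs⟩⟩
  · obtain ⟨s, hs⟩ := Farey.exists_isPotential
      (G := fun x y => Farey.lift (fun q => V q) x y) (Farey.lift_even fun q => V q)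
    exact ⟨s, Farey.isInfinitesimalShear_iff.2 hs, fun s' hs' =>
      (Farey.isInfinitesimalShear_iff.1 hs').unique hs⟩
  · rintro ⟨V, hV, hs⟩
    exact hV.exists_cesaroBound hs
  · rintro ⟨C, hC, hs⟩
    exact hs.exists_vectorField hC
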